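/- Let $n\ge 0$ be an integer (for $n=0$ read $\mathbb C^0$ as a point), and let $$D=\{(z,w)\in\mathbb C^n\times\mathbb C:\ |w|^2<e^{-|z|^2}\},\qquad |z|^2=\sum_{j=1}^n|z_j|^2 .$$ Let $A^2(D)$ be the Bergman space of $D$, that is, the space of holomorphic functions on $D$ that are square integrable for Lebesgue measure, with the $L^2$ inner product. Then the following hold. 1. $D$ is a pseudoconvex domain: it is open and connected and has a continuous plurisubharmonic exhaustion function. It is also complete Reinhardt: if $(z,w)\in D$ and all $|c_j|\le 1$, $|d|\le 1$, then $(c_1z_1,\dots,c_nz_n,dw)\in D$. 2. The monomials $z^\alpha w^q$ ($\alpha\in\mathbb N_0^n$, $q\in\mathbb N_0$) lie in $A^2(D)$, are pairwise orthogonal, and satisfy $$\|z^\alpha w^q\|^2_{L^2(D)}=\int_D|z^\alpha w^q|^2\,dv=\frac{\pi^{n+1}\,\alpha!}{(q+1)^{|\alpha|+n+1}} .$$ Divided by their norms they form an orthonormal Hilbert basis of $A^2(D)$. 3. Let $K=\sum_j|\varphi_j|^2$, where $(\varphi_j)$ is any orthonormal Hilbert basis of $A^2(D)$. The sum converges at each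 point of $D$, $K$ is positive and smooth on $D$, and the Bergman metric $g_{a\bar b}=\partial^2\log K/\partial z_a\partial\bar z_b$ (with $z_{n+1}=w$) is positive definite at every point of $D$. 4. The map $\iota:\mathbb C^n\to D$, $\iota(z)=(z,0)$, is a holomorphic embedding with closed image $\mathbb C^n\times\{0\}$. The Bergman metric restricts to the Euclidean metric on it: $g_{\iota(z)}\big((u,0),(v,0)\big)=\sum_j u_j\bar v_j$ for all $z,u,v\in\mathbb C^n$. 5. The complex submanifold $\mathbb C^n\times\{0\}$ is totally geodesic in $D$ with the Bergman metric (its second fundamental form is identically zero) and flat: the curvature tensor of the induced metric is zero. Moreover, at each point of $\mathbb C^n\times\{0\}$ the holomorphic sectional curvature of the Bergman metric of $D$ is zero in every nonzero direction tangent to $\mathbb C^n\times\{0\}$. -/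

import Mathlib

open MeasureTheory
open scoped ContDiff

/-! ### Pseudoconvexity -/

/-- A continuous (finite valued) function is plurisubharmonic on `Ω` if it satisfies the sub-mean
value inequality on every closed disc `{p + ζ v : |ζ| ≤ 1}` contained in `Ω`. -/
def IsContinuousPSHOn {E : Type*} [NormedAddCommGroup E] [NormedSpace ℂ E]
    (φ : E → ℝ) (Ω : Set E) : Prop :=
  ContinuousOn φ Ω ∧
    ∀ p v : E, (∀ ζ : ℂ, ‖ζ‖ ≤ 1 → p + ζ • v ∈ Ω) →
      φ p ≤ Real.circleAverage (fun ζ : ℂ => φ (p + ζ • v)) 0 1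

/-- An open set is pseudoconvex if it has a continuous plurisubharmonic exhaustion function. -/
def IsPseudoconvex {E : Type*} [NormedAddCommGroup E] [NormedSpace ℂ E] (Ω : Set E) : Prop :=
  IsOpen Ω ∧ ∃ φ : E → ℝ, IsContinuousPSHOn φ Ω ∧ ∀ c : ℝ, IsCompact {p | p ∈ Ω ∧ φ p ≤ c}

/-! ### Bergman space, Bergman kernel and Bergman metric -/

/-- The Bergman space `A²(Ω)`: the subspace of `L²(Ω)` (with respect to Lebesgue measure) of the
functions that are holomorphic on `Ω`. -/
noncomputable def BergmanSpace {E : Type*} [NormedAddCommGroup E] [NormedSpace ℂ E]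
    [MeasureSpace E] (Ω : Set E) :
    Submodule ℂ (Lp ℂ 2 ((volume : Measure E).restrict Ω)) where
  carrier := {f | ∃ F : E → ℂ, DifferentiableOn ℂ F Ω ∧
    (f : E → ℂ) =ᵐ[(volume : Measure E).restrict Ω] F}
  add_mem' := by
    rintro f g ⟨F, hF, hf⟩ ⟨G, hG, hg⟩
    exact ⟨F + G, hF.add hG, (Lp.coeFn_add f g).trans (hf.add hg)⟩
  zero_mem' := ⟨0, differentiableOn_const 0, Lp.coeFn_zero _ _ _⟩
  smul_mem' := by
    rintro c f ⟨F, hF, hf⟩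
    exact ⟨c • F, hF.const_smul c, (Lp.coeFn_smul c f).trans (hf.const_smul c)⟩

/-- The holomorphic function that represents an element of `A²(Ω)`; for open `Ω` its values on `Ω`
are uniquely determined, and its values outside `Ω` are irrelevant. -/
noncomputable def holomorphicRep {E : Type*} [NormedAddCommGroup E] [NormedSpace ℂ E]
    [MeasureSpace E] {Ω : Set E} (f : BergmanSpace Ω) : E → ℂ :=
  Classical.choose f.2

/-- The Bergman kernel on the diagonal, `K(p) = ∑ⱼ |φⱼ(p)|²`, computed with an orthonormal
(Hilbert) basis `φ` of `A²(Ω)`. -/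
noncomputable def bergmanKernel {E : Type*} [NormedAddCommGroup E] [NormedSpace ℂ E]
    [MeasureSpace E] {Ω : Set E} {J : Type*} (φ : HilbertBasis J ℂ (BergmanSpace Ω)) (p : E) : ℝ :=
  ∑' j, ‖holomorphicRep (φ j) p‖ ^ 2

/-- Multiplication by `i`, as a real linear map. -/
noncomputable def mulI (E : Type*) [NormedAddCommGroup E] [NormedSpace ℂ E] [NormedSpace ℝ E]
    [IsScalarTower ℝ ℂ E] : E →L[ℝ] E :=
  (Complex.I • ContinuousLinearMap.id ℂ E).restrictScalars ℝ

/-- The Hermitian form `(u, v) ↦ ∂_u ∂̄_v f (p)` of `∂∂̄f`, where `∂_u = (D_u - i D_{iu}) / 2` and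
`∂̄_v = (D_v + i D_{iv}) / 2`. On coordinate vectors it is `∂²f / ∂z_a ∂z̄_b`. -/
noncomputable def complexHessian {E : Type*} [NormedAddCommGroup E] [NormedSpace ℂ E]
    [NormedSpace ℝ E] [IsScalarTower ℝ ℂ E] (f : E → ℝ) (p u v : E) : ℂ :=
  let H := fderiv ℝ (fderiv ℝ f) p
  let i := mulI E
  (1 / 4 : ℂ) * (((H u v + H (i u) (i v) : ℝ) : ℂ)
    + Complex.I * ((H u (i v) - H (i u) v : ℝ) : ℂ))

/-- The real bilinear form `Re (∂_u ∂̄_v f (p))`, see `re_complexHessian`. -/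
noncomputable def realComplexHessian {E : Type*} [NormedAddCommGroup E] [NormedSpace ℂ E]
    [NormedSpace ℝ E] [IsScalarTower ℝ ℂ E] (f : E → ℝ) (p : E) : E →L[ℝ] E →L[ℝ] ℝ :=
  (1 / 4 : ℝ) • (fderiv ℝ (fderiv ℝ f) p
    + (fderiv ℝ (fderiv ℝ f) p).bilinearComp (mulI E) (mulI E))

theorem re_complexHessian {E : Type*} [NormedAddCommGroup E] [NormedSpace ℂ E]
    [NormedSpace ℝ E] [IsScalarTower ℝ ℂ E] (f : E → ℝ) (p u v : E) :
    (complexHessian f p u v).re = realComplexHessian f p u v := by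
  have h : (1 / 4 : ℂ) = ((1 / 4 : ℝ) : ℂ) := by norm_num
  simp only [complexHessian, realComplexHessian]
  rw [h, Complex.re_ofReal_mul, Complex.add_re, Complex.ofReal_re, Complex.re_mul_ofReal]
  simp [mul_add]

/-- The Bergman metric tensor `g_{a b̄} = ∂² log K / ∂z_a ∂z̄_b`, as a field of Hermitian forms. -/
noncomputable def bergmanMetric {E : Type*} [NormedAddCommGroup E] [NormedSpace ℂ E]
    [NormedSpace ℝ E] [IsScalarTower ℝ ℂ E] [MeasureSpace E] {Ω : Set E} {J : Type*}
    (φ : HilbertBasis J ℂ (BergmanSpace Ω)) (p u v : E) : ℂ :=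
  complexHessian (fun q => Real.log (bergmanKernel φ q)) p u v

/-- The underlying Riemannian metric `Re g` of the Bergman metric. -/
noncomputable def bergmanRiemannian {E : Type*} [NormedAddCommGroup E] [NormedSpace ℂ E]
    [NormedSpace ℝ E] [IsScalarTower ℝ ℂ E] [MeasureSpace E] {Ω : Set E} {J : Type*}
    (φ : HilbertBasis J ℂ (BergmanSpace Ω)) (p : E) : E →L[ℝ] E →L[ℝ] ℝ :=
  realComplexHessian (fun q => Real.log (bergmanKernel φ q)) p

/-! ### Riemannian geometry of a metric `h` on an open subset of a vector space -/

/-- Christoffel symbols of the first kind: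
`w ↦ (D_u h (v, w) + D_v h (u, w) - D_w h (u, v)) / 2`, for constant `u, v, w`. -/
noncomputable def christoffelLower {E : Type*} [NormedAddCommGroup E] [NormedSpace ℝ E]
    (h : E → E →L[ℝ] E →L[ℝ] ℝ) (p u v : E) : E →L[ℝ] ℝ :=
  (1 / 2 : ℝ) • (fderiv ℝ h p u v + fderiv ℝ h p v u - ((fderiv ℝ h p).flip u).flip v)

/-- The Levi-Civita connection `∇_u v` for constant vector fields `u, v` (Christoffel symbols of the
second kind): the vector that represents `christoffelLower h p u v` with respect to `h p`. -/
noncomputable def christoffel {E : Type*} [NormedAddCommGroup E] [NormedSpace ℝ E]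
    (h : E → E →L[ℝ] E →L[ℝ] ℝ) (p u v : E) : E :=
  (h p).inverse (christoffelLower h p u v)

/-- The Riemann curvature tensor `R(u, v) x = ∇_u ∇_v x - ∇_v ∇_u x - ∇_[u, v] x`. -/
noncomputable def riemannCurvature {E : Type*} [NormedAddCommGroup E] [NormedSpace ℝ E]
    (h : E → E →L[ℝ] E →L[ℝ] ℝ) (p u v x : E) : E :=
  fderiv ℝ (fun q => christoffel h q v x) p u - fderiv ℝ (fun q => christoffel h q u x) p v
    + christoffel h p u (christoffel h p v x) - christoffel h p v (christoffel h p u x)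

/-- The holomorphic sectional curvature: the sectional curvature of the real plane spanned by `u` and
`i u`, for a metric with `h (i u, i v) = h (u, v)`. -/
noncomputable def holSectionalCurvature {E : Type*} [NormedAddCommGroup E] [NormedSpace ℂ E]
    [NormedSpace ℝ E] [IsScalarTower ℝ ℂ E] (h : E → E →L[ℝ] E →L[ℝ] ℝ) (p u : E) : ℝ :=
  h p (riemannCurvature h p u (mulI E u) (mulI E u)) u / (h p u u) ^ 2

/-- The metric `s^* h` induced by an immersion `s`. -/
noncomputable def inducedMetric {E F : Type*} [NormedAddCommGroup E] [NormedSpace ℝ E]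
    [NormedAddCommGroup F] [NormedSpace ℝ F] (h : E → E →L[ℝ] E →L[ℝ] ℝ) (s : F → E) (z : F) :
    F →L[ℝ] F →L[ℝ] ℝ :=
  (h (s z)).bilinearComp (fderiv ℝ s z) (fderiv ℝ s z)

/-- The ambient covariant derivative `∇_{ds u} (ds v)` along the immersion `s`, for constant vector
fields `u, v` of the parameter space. -/
noncomputable def covDerivAlong {E F : Type*} [NormedAddCommGroup E] [NormedSpace ℝ E]
    [NormedAddCommGroup F] [NormedSpace ℝ F] (h : E → E →L[ℝ] E →L[ℝ] ℝ) (s : F → E) (z u v : F) :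
    E :=
  fderiv ℝ (fderiv ℝ s) z u v + christoffel h (s z) (fderiv ℝ s z u) (fderiv ℝ s z v)

/-- The immersion `s` is totally geodesic: its second fundamental form, the normal component of
`∇_{ds u} (ds v)`, vanishes identically. -/
def IsTotallyGeodesic {E F : Type*} [NormedAddCommGroup E] [NormedSpace ℝ E]
    [NormedAddCommGroup F] [NormedSpace ℝ F] (h : E → E →L[ℝ] E →L[ℝ] ℝ) (s : F → E) : Prop :=
  ∀ (z u v : F) (ν : E), (∀ x : F, h (s z) (fderiv ℝ s z x) ν = 0) →
    h (s z) (covDerivAlong h s z u v) ν = 0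

/-! ### The domain -/

/-- The domain `D = {(z, w) ∈ ℂⁿ × ℂ : |w|² < exp (-|z|²)}`. -/
def hartogsDomain (n : ℕ) : Set ((Fin n → ℂ) × ℂ) :=
  {p | ‖p.2‖ ^ 2 < Real.exp (-∑ i, ‖p.1 i‖ ^ 2)}

/-- A complete Reinhardt set: stable under multiplying each coordinate by a number of modulus at
most one. -/
def IsCompleteReinhardt {n : ℕ} (Ω : Set ((Fin n → ℂ) × ℂ)) : Prop :=
  ∀ p ∈ Ω, ∀ (c : Fin n → ℂ) (d : ℂ), (∀ i, ‖c i‖ ≤ 1) → ‖d‖ ≤ 1 →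
    ((fun i => c i * p.1 i, d * p.2) : (Fin n → ℂ) × ℂ) ∈ Ω

/-- The monomial `z^α w^q`. -/
def hartogsMonomial {n : ℕ} (α : Fin n → ℕ) (q : ℕ) (p : (Fin n → ℂ) × ℂ) : ℂ :=
  (∏ i, p.1 i ^ α i) * p.2 ^ q

/-- The number `π^{n+1} α! / (q+1)^{|α|+n+1}`. -/
noncomputable def hartogsNormSq {n : ℕ} (α : Fin n → ℕ) (q : ℕ) : ℝ :=
  Real.pi ^ (n + 1) * (∏ i, ((α i).factorial : ℝ)) / ((q : ℝ) + 1) ^ ((∑ i, α i) + n + 1)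

/-- The embedding `z ↦ (z, 0)` of `ℂⁿ`. -/
def sliceEmbedding (n : ℕ) (z : Fin n → ℂ) : (Fin n → ℂ) × ℂ := (z, 0)

/-! The proof rests on a closed form for the Bergman kernel. Put `t = |w|² exp |z|²`, so that `D` is
`t < 1`, and `S_k(t) = ∑ (q + 1)^k t^q`. Summing `|z^α w^q|² / ‖z^α w^q‖²` over `α` first gives
exponential series, and `K = π^{-(n+1)} exp(|z|²) S_{n+1}(t)`. Hence `log K = const + |z|² + log
S_{n+1}(t)`, and differentiating twice, `g(u, v) = (S_{n+2}/S_{n+1})(t) ⟨u', v'⟩ +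
(S_{n+2}/S_{n+1})'(t) exp(|z|²) ℓ(u) conj(ℓ(v))`, where `u'` is the `ℂⁿ`-component of `u`, `u_w` its
last coordinate, and `ℓ(u) = u_w + w ⟨u', z⟩` (`bergmanMetric_hartogsDomain`). Both coefficients are
positive, the second by strict log-convexity of `k ↦ S_k(t)` (`sq_succPowSeries_lt`) and a direct
value at `t = 0`. On the slice `w = 0` one has `t = 0` and `S_k(0) = 1`, so `g` is Euclidean there
on tangent vectors.

The slice is the fixed set of the isometry `(z, w) ↦ (z, -w)`, which forces it to be totally
geodesic. Concretely, the tangential metric entries are even in `w` and constant along the slice, so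
the Christoffel symbols with tangential arguments vanish on it (`christoffel_slice`). Curvature
evaluated on tangent vectors involves only these symbols and their derivatives along the slice, so
it vanishes too.

The analytic input is that the monomials form a Hilbert basis. Orthogonality comes from the torus
action. Completeness (`eqOn_zero_of_orthogonal_hartogsMonomial`) comes from expanding a holomorphic
function into homogeneous polynomials along complex lines through `0`: averaging over circles shows
that the pairing of `F` with its own degree `m` component is a positive multiple of that component's
squared norm. Independence of `K` from the basis is the Riesz representation of point evaluation.

Pseudoconvexity uses the exhaustion `|z|² + 1/(1 - t)`, which at every point is touched from below
by the real part of a holomorphic function. -/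

/-! ### Holomorphic functions on complex normed spaces -/

section Holomorphic

open Metric Filter Topology

variable {E F : Type*} [NormedAddCommGroup E] [NormedSpace ℂ E]
  [NormedAddCommGroup F] [NormedSpace ℂ F]

/-- Cauchy estimate in Schwarz form: the values stay within `2 * C` of `f c`, whence the factor 2.
-/
theorem norm_fderiv_le_of_forall_mem_ball {f : E → F} {c : E} {R C : ℝ} (hR : 0 < R)
    (hd : DifferentiableOn ℂ f (ball c R)) (hC : ∀ z ∈ ball c R, ‖f z‖ ≤ C) :
    ‖fderiv ℂ f c‖ ≤ 2 * C / R := by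
  refine Complex.norm_fderiv_le_div_of_mapsTo_ball hd (fun z hz => ?_) hR
  rw [mem_closedBall, dist_eq_norm]
  have h1 := hC z hz
  have h2 := hC c (mem_ball_self hR)
  linarith [norm_sub_le (f z) (f c)]

/-- Uniform limits of holomorphic functions on open sets are holomorphic. -/
theorem TendstoUniformlyOn.differentiableOn_complex [CompleteSpace F]
    {f : ℕ → E → F} {g : E → F} {U : Set E} (hU : IsOpen U)
    (hf : ∀ n, DifferentiableOn ℂ (f n) U) (hfg : TendstoUniformlyOn f g atTop U) :
    DifferentiableOn ℂ g U := by
  intro x hx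
  obtain ⟨R, hR, hRU⟩ := Metric.isOpen_iff.1 hU x hx
  obtain ⟨r, hr, rfl⟩ : ∃ r > 0, R = r + r := ⟨R / 2, by positivity, by ring⟩
  have hsub : ∀ y ∈ ball x r, ball y r ⊆ U := fun y hy =>
    (ball_subset_ball' (by linarith [mem_ball.1 hy])).trans hRU
  have hcau : UniformCauchySeqOn (fun n => fderiv ℂ (f n)) atTop (ball x r) := by
    rw [Metric.uniformCauchySeqOn_iff]
    intro ε hε
    -- The Cauchy estimate on `ball y r` turns this tolerance into `2 * (ε * r / 4) / r = ε / 2` for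
    -- the derivatives.
    obtain ⟨N, hN⟩ := Metric.uniformCauchySeqOn_iff.1 hfg.uniformCauchySeqOn (ε * r / 4)
      (by positivity)
    refine ⟨N, fun m hm n hn y hy => ?_⟩
    have hy' := hsub y hy
    have hd : ∀ k, DifferentiableAt ℂ (f k) y := fun k =>
      (hf k).differentiableAt (hU.mem_nhds (hy' (mem_ball_self hr)))
    rw [dist_eq_norm, ← fderiv_sub (hd m) (hd n)]
    refine (norm_fderiv_le_of_forall_mem_ball (C := ε * r / 4) hr
      (((hf m).sub (hf n)).mono hy') fun z hz => ?_).trans_lt ?_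
    · have := hN m hm n hn z (hy' hz)
      rw [dist_eq_norm] at this
      exact this.le
    · rw [div_lt_iff₀ hr]
      nlinarith
  have hex : ∀ y : E, ∃ g' : E →L[ℂ] F, y ∈ ball x r →
      Tendsto (fun n => fderiv ℂ (f n) y) atTop (𝓝 g') := by
    intro y
    by_cases hy : y ∈ ball x r
    · obtain ⟨g', hg'⟩ := CompleteSpace.complete (hcau.cauchy_map hy)
      exact ⟨g', fun _ => hg'⟩
    · exact ⟨0, fun h => absurd h hy⟩
  choose g' hg' using hex
  refine (hasFDerivAt_of_tendstoUniformlyOn (𝕜 := ℂ) (g' := g') (f := f) isOpen_ball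
    (hcau.tendstoUniformlyOn_of_tendsto hg') (fun n y hy => ?_) (fun y hy => ?_)
    (mem_ball_self hr)).differentiableAt.differentiableWithinAt
  · exact ((hf n).differentiableAt (hU.mem_nhds (hsub y hy (mem_ball_self hr)))).hasFDerivAt
  · exact hfg.tendsto_at (hsub y hy (mem_ball_self hr))

/-- Apply the Cauchy estimate to the difference of `f` and its translate by `z - y`: it is `O(‖y -
z‖)` because `f` is Lipschitz where its derivative is bounded, and its derivative at `y` is the
difference to be estimated. The nested radii `4r`, `3r`, `r` leave room for both estimates and the
translation. -/
theorem DifferentiableOn.exists_lipschitz_fderiv {f : E → F} {U : Set E} (hU : IsOpen U)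
    (hf : DifferentiableOn ℂ f U) {x : E} (hx : x ∈ U) :
    ∃ r > 0, ∃ K : ℝ, ball x r ⊆ U ∧
      ∀ y ∈ ball x r, ∀ z ∈ ball x r, ‖fderiv ℂ f y - fderiv ℂ f z‖ ≤ K * ‖y - z‖ := by
  have hc : ContinuousAt f x := (hf.differentiableAt (hU.mem_nhds hx)).continuousAt
  obtain ⟨R₁, hR₁, h₁⟩ := Metric.isOpen_iff.1 hU x hx
  obtain ⟨R₂, hR₂, h₂⟩ := Metric.continuousAt_iff.1 hc 1 one_pos
  set r := min R₁ R₂ / 4 with hr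
  have hr0 : 0 < r := by positivity
  have hsub : ball x (4 * r) ⊆ U :=
    (ball_subset_ball (by rw [hr]; linarith [min_le_left R₁ R₂])).trans h₁
  have hbd : ∀ y ∈ ball x (4 * r), ‖f y‖ ≤ ‖f x‖ + 1 := by
    intro y hy
    have := h₂ (lt_of_lt_of_le (mem_ball.1 hy) (by rw [hr]; linarith [min_le_right R₁ R₂]))
    rw [dist_eq_norm] at this
    linarith [norm_le_insert' (f y) (f x)]
  have hball : ∀ {y : E} {a b : ℝ}, y ∈ ball x a → ball y b ⊆ ball x (a + b) := by
    intro y a b hy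
    refine ball_subset_ball' ?_
    linarith [mem_ball.1 hy]
  set M := 2 * (‖f x‖ + 1) / r
  have hM : ∀ y ∈ ball x (3 * r), ‖fderiv ℂ f y‖ ≤ M := by
    intro y hy
    have hs : ball y r ⊆ ball x (4 * r) := (hball hy).trans (ball_subset_ball (by linarith))
    exact norm_fderiv_le_of_forall_mem_ball hr0 (hf.mono (hs.trans hsub)) fun z hz => hbd z (hs hz)
  have hLip : ∀ y ∈ ball x (3 * r), ∀ z ∈ ball x (3 * r), ‖f y - f z‖ ≤ M * ‖y - z‖ := by
    intro y hy z hz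
    refine (convex_ball x (3 * r)).norm_image_sub_le_of_norm_fderiv_le (𝕜 := ℂ) ?_ hM hz hy
    intro w hw
    exact hf.differentiableAt (hU.mem_nhds (hsub (ball_subset_ball (by linarith) hw)))
  refine ⟨r, hr0, 2 * M / r, (ball_subset_ball (by linarith)).trans hsub, ?_⟩
  intro y hy z hz
  have hdiff : ∀ w ∈ ball x (3 * r), DifferentiableAt ℂ f w := fun w hw =>
    hf.differentiableAt (hU.mem_nhds (hsub (ball_subset_ball (by linarith) hw)))
  have hmem : ∀ w ∈ ball y r, w ∈ ball x (3 * r) ∧ w + (z - y) ∈ ball x (3 * r) := by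
    intro w hw
    rw [mem_ball, dist_eq_norm] at hw hy hz
    simp only [mem_ball, dist_eq_norm]
    constructor
    · calc ‖w - x‖ = ‖(w - y) + (y - x)‖ := by congr 1; abel
        _ ≤ ‖w - y‖ + ‖y - x‖ := norm_add_le _ _
        _ < 3 * r := by linarith
    · calc ‖w + (z - y) - x‖ = ‖(w - y) + (z - x)‖ := by congr 1; abel
        _ ≤ ‖w - y‖ + ‖z - x‖ := norm_add_le _ _
        _ < 3 * r := by linarith
  have hy' := hmem y (mem_ball_self hr0)
  have hfd : fderiv ℂ (fun w => f w - f (w + (z - y))) y = fderiv ℂ f y - fderiv ℂ f z := by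
    have h2 : DifferentiableAt ℂ (fun w => f (w + (z - y))) y :=
      (hdiff _ hy'.2).comp y (by fun_prop)
    rw [fderiv_fun_sub (hdiff y hy'.1) h2, fderiv_comp_add_right]
    simp
  rw [← hfd]
  refine (norm_fderiv_le_of_forall_mem_ball (C := M * ‖y - z‖) hr0 (fun w hw => ?_)
    (fun w hw => ?_)).trans (le_of_eq (by ring))
  · exact ((hdiff w (hmem w hw).1).sub
      ((hdiff _ (hmem w hw).2).comp w (by fun_prop))).differentiableWithinAt
  · refine (hLip w (hmem w hw).1 _ (hmem w hw).2).trans (le_of_eq ?_)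
    congr 2
    abel

/-- Directional derivatives of holomorphic functions are holomorphic. -/
theorem DifferentiableOn.fderiv_apply_complex [CompleteSpace F] {f : E → F} {U : Set E}
    (hU : IsOpen U) (hf : DifferentiableOn ℂ f U) (v : E) :
    DifferentiableOn ℂ (fun x => fderiv ℂ f x v) U := by
  intro x hx
  obtain ⟨r, hr, K, hrU, hK⟩ := hf.exists_lipschitz_fderiv hU hx
  set B := ball x (r / 2)
  have hBU : B ⊆ U := (ball_subset_ball (by linarith)).trans hrU
  -- The directional derivative is a uniform limit of difference quotients with step `1 / (n + N +
  -- 1)`. The offset `N` keeps the displaced points inside `ball x r`; the Lipschitz bound on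
  -- `fderiv ℂ f` makes the error `O(1 / n)`.
  obtain ⟨N, hN⟩ := exists_nat_gt (‖v‖ / (r / 2))
  have hN0 : ∀ n : ℕ, 0 < ((n + N + 1 : ℕ) : ℝ) := fun n => by positivity
  have hsmall : ∀ n : ℕ, ‖v‖ / ((n + N + 1 : ℕ) : ℝ) < r / 2 := by
    intro n
    rw [div_lt_iff₀ (by positivity)] at hN ⊢
    refine hN.trans_le ?_
    rw [mul_comm]
    gcongr
    linarith
  let φ : ℕ → E → F := fun n y => ((n + N + 1 : ℕ) : ℂ) •
    (f (y + ((n + N + 1 : ℕ) : ℂ)⁻¹ • v) - f y)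
  have hnorm : ∀ n : ℕ, ‖((n + N + 1 : ℕ) : ℂ)⁻¹ • v‖ = ‖v‖ / ((n + N + 1 : ℕ) : ℝ) := by
    intro n
    rw [norm_smul, norm_inv, Complex.norm_natCast, inv_mul_eq_div]
  have hdiff : ∀ w ∈ ball x r, DifferentiableAt ℂ f w := fun w hw =>
    hf.differentiableAt (hU.mem_nhds (hrU hw))
  have hmem : ∀ n : ℕ, ∀ y ∈ B, closedBall y (‖v‖ / ((n + N + 1 : ℕ) : ℝ)) ⊆ ball x r := by
    intro n y hy w hw
    have h1 := hsmall n
    have h2 := mem_closedBall.1 hw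
    have h3 := mem_ball.1 hy
    rw [mem_ball]
    linarith [dist_triangle w y x]
  have hmem' : ∀ n : ℕ, ∀ y ∈ B, y + ((n + N + 1 : ℕ) : ℂ)⁻¹ • v ∈
      closedBall y (‖v‖ / ((n + N + 1 : ℕ) : ℝ)) := by
    intro n y _
    rw [mem_closedBall, dist_eq_norm, add_sub_cancel_left, hnorm]
  have hφ : ∀ n, DifferentiableOn ℂ (φ n) B := by
    intro n y hy
    refine DifferentiableAt.differentiableWithinAt ?_
    refine DifferentiableAt.const_smul (DifferentiableAt.sub ?_ ?_) _
    · exact (hdiff _ (hmem n y hy (hmem' n y hy))).comp y (by fun_prop)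
    · exact hdiff _ (ball_subset_ball (by linarith) hy)
  have hest : ∀ n, ∀ y ∈ B, ‖φ n y - fderiv ℂ f y v‖ ≤
      |K| * ‖v‖ ^ 2 / ((n + N + 1 : ℕ) : ℝ) := by
    intro n y hy
    have hyr : y ∈ ball x r := ball_subset_ball (by linarith) hy
    have key := (convex_closedBall y (‖v‖ / ((n + N + 1 : ℕ) : ℝ))).norm_image_sub_le_of_norm_fderiv_le'
      (𝕜 := ℂ) (f := f) (φ := fderiv ℂ f y) (C := |K| * (‖v‖ / ((n + N + 1 : ℕ) : ℝ)))
      (fun w hw => hdiff w (hmem n y hy hw)) (fun w hw => ?_)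
      (mem_closedBall_self (by positivity)) (hmem' n y hy)
    · rw [add_sub_cancel_left, hnorm] at key
      have hne : ((n + N + 1 : ℕ) : ℂ) ≠ 0 := by exact_mod_cast (hN0 n).ne'
      have : φ n y - fderiv ℂ f y v = ((n + N + 1 : ℕ) : ℂ) •
          (f (y + ((n + N + 1 : ℕ) : ℂ)⁻¹ • v) - f y -
            fderiv ℂ f y (((n + N + 1 : ℕ) : ℂ)⁻¹ • v)) := by
        rw [smul_sub, map_smul, smul_smul, mul_inv_cancel₀ hne, one_smul]
      rw [this, norm_smul, Complex.norm_natCast]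
      refine (mul_le_mul_of_nonneg_left key (hN0 n).le).trans (le_of_eq ?_)
      have := (hN0 n).ne'
      field_simp
    · refine (hK w (hmem n y hy hw) y hyr).trans ?_
      rw [← dist_eq_norm]
      exact mul_le_mul (le_abs_self K) (mem_closedBall.1 hw) dist_nonneg (abs_nonneg K)
  have hlim : TendstoUniformlyOn φ (fun y => fderiv ℂ f y v) atTop B := by
    rw [Metric.tendstoUniformlyOn_iff]
    intro ε hε
    have ht : Tendsto (fun n : ℕ => |K| * ‖v‖ ^ 2 / ((n + N + 1 : ℕ) : ℝ)) atTop (𝓝 0) := by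
      refine Tendsto.div_atTop tendsto_const_nhds ?_
      exact tendsto_natCast_atTop_atTop.comp (tendsto_atTop_mono (fun n => by simp only [id]; omega) tendsto_id)
    filter_upwards [ht.eventually (gt_mem_nhds hε)] with n hn y hy
    rw [dist_comm, dist_eq_norm]
    exact (hest n y hy).trans_lt hn
  exact ((hlim.differentiableOn_complex isOpen_ball hφ).differentiableAt
    (isOpen_ball.mem_nhds (mem_ball_self (by linarith)))).differentiableWithinAt

end Holomorphic

/-! ### Rotation averages and the Bergman space -/

section Bergman

open Metric Filter Topology

variable {E : Type*} [NormedAddCommGroup E] [NormedSpace ℂ E]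

theorem circleAverage_add_smul_of_ball_subset {F : E → ℂ} {p : E} {r : ℝ}
    (hF : DifferentiableOn ℂ F (ball p r)) {x : E} (hx : x ∈ ball 0 r) :
    Real.circleAverage (fun c : ℂ => F (p + c • x)) 0 1 = F p := by
  have h : DifferentiableOn ℂ (fun c : ℂ => F (p + c • x)) (closedBall 0 |1|) := by
    refine hF.comp (by fun_prop) fun c hc => ?_
    rw [abs_one, mem_closedBall_zero_iff] at hc
    rw [mem_ball_zero_iff] at hx
    rw [mem_ball_iff_norm, add_sub_cancel_left, norm_smul]
    nlinarith [norm_nonneg x]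
  simpa using (h.diffContOnCl_ball (Set.Subset.refl _)).circleAverage

variable [MeasureSpace E] {Ω : Set E}

theorem holomorphicRep_differentiableOn (f : BergmanSpace Ω) :
    DifferentiableOn ℂ (holomorphicRep f) Ω := (Classical.choose_spec f.2).1

theorem coeFn_ae_eq_holomorphicRep (f : BergmanSpace Ω) :
    ((f : Lp ℂ 2 ((volume : Measure E).restrict Ω)) : E → ℂ)
      =ᵐ[(volume : Measure E).restrict Ω] holomorphicRep f := (Classical.choose_spec f.2).2

/-- This makes the arbitrary choice of representative harmless: continuous functions that agree
almost everywhere on an open set agree on it. -/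
theorem holomorphicRep_eqOn [(volume : Measure E).IsOpenPosMeasure] (hΩ : IsOpen Ω) (f : BergmanSpace Ω) {F : E → ℂ}
    (hF : ContinuousOn F Ω)
    (h : ((f : Lp ℂ 2 ((volume : Measure E).restrict Ω)) : E → ℂ)
      =ᵐ[(volume : Measure E).restrict Ω] F) : Set.EqOn (holomorphicRep f) F Ω :=
  Measure.eqOn_open_of_ae_eq ((coeFn_ae_eq_holomorphicRep f).symm.trans h) hΩ
    (holomorphicRep_differentiableOn f).continuousOn hF

theorem holomorphicRep_memLp (f : BergmanSpace Ω) :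
    MemLp (holomorphicRep f) 2 (volume.restrict Ω) :=
  (memLp_congr_ae (coeFn_ae_eq_holomorphicRep f)).1 (Lp.memLp _)

variable [BorelSpace E] [ProperSpace E] [(volume : Measure E).IsAddHaarMeasure]

/-- The image measure is again a Haar measure, hence a multiple of `volume`; the unit ball is
invariant and has finite positive measure, so the multiple is one. -/
theorem measurePreserving_smul_of_norm_eq_one {c : ℂ} (hc : ‖c‖ = 1) :
    MeasurePreserving (fun x : E => c • x) volume volume := by
  have hc0 : c ≠ 0 := norm_ne_zero_iff.1 (by rw [hc]; exact one_ne_zero)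
  have hm : Measurable (fun x : E => c • x) := (continuous_const_smul c).measurable
  refine ⟨hm, ?_⟩
  have : ((volume : Measure E).map (fun x : E => c • x)).IsAddHaarMeasure :=
    (ContinuousLinearEquiv.smulLeft (R₁ := ℂ) (M₁ := E)
      (Units.mk0 c hc0)).isAddHaarMeasure_map volume
  have h := Measure.isAddLeftInvariant_eq_smul ((volume : Measure E).map (fun x : E => c • x))
    volume
  have hb := congrArg (fun μ : Measure E => μ (ball 0 1)) h
  simp only [Measure.smul_apply] at hb
  rw [Measure.map_apply hm measurableSet_ball] at hb
  have hpre : (fun x : E => c • x) ⁻¹' ball 0 1 = ball 0 1 := by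
    ext x
    simp [norm_smul, hc]
  rw [hpre] at hb
  rw [h]
  set κ := Measure.addHaarScalarFactor (Measure.map (fun x : E => c • x) volume) volume
  have h1 : (κ : ENNReal) = 1 := by
    have h0 : (volume : Measure E) (ball 0 1) ≠ 0 := (measure_ball_pos _ _ one_pos).ne'
    have ht : (volume : Measure E) (ball 0 1) ≠ ⊤ := measure_ball_lt_top.ne
    rw [ENNReal.smul_def, smul_eq_mul] at hb
    exact ((ENNReal.mul_eq_right h0 ht).1 hb.symm)
  have h1' : κ = 1 := by exact_mod_cast h1
  rw [h1', one_smul]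

/-- The integral over a circled open set can be computed by first averaging over the orbits of the
circle action. -/
theorem setIntegral_eq_setIntegral_circleAverage {S : Set E} (hS : IsOpen S)
    (hinv : ∀ c : ℂ, ‖c‖ = 1 → ∀ x ∈ S, c • x ∈ S) {G : E → ℂ} (hG : ContinuousOn G S)
    (hint : IntegrableOn G S) :
    ∫ x in S, G x = ∫ x in S, Real.circleAverage (fun c : ℂ => G (c • x)) 0 1 := by
  have hn : ∀ θ : ℝ, ‖circleMap 0 1 θ‖ = 1 := fun θ => by simp
  have hpre : ∀ θ : ℝ, (fun x : E => circleMap 0 1 θ • x) ⁻¹' S = S := by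
    intro θ
    ext x
    refine ⟨fun hx => ?_, fun hx => hinv _ (hn θ) x hx⟩
    have h0 : circleMap 0 1 θ ≠ 0 := norm_ne_zero_iff.1 (by rw [hn θ]; exact one_ne_zero)
    have := hinv (circleMap 0 1 θ)⁻¹ (by rw [norm_inv, hn θ, inv_one]) _ hx
    simpa [smul_smul, inv_mul_cancel₀ h0] using this
  have hemb : ∀ θ : ℝ, MeasurableEmbedding (fun x : E => circleMap 0 1 θ • x) := by
    intro θ
    have h0 : circleMap 0 1 θ ≠ 0 := norm_ne_zero_iff.1 (by rw [hn θ]; exact one_ne_zero)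
    exact (Homeomorph.smulOfNeZero _ h0).measurableEmbedding
  have hmp : ∀ θ : ℝ, MeasurePreserving (fun x : E => circleMap 0 1 θ • x) volume volume :=
    fun θ => measurePreserving_smul_of_norm_eq_one (hn θ)
  have hrot : ∀ θ : ℝ, ∫ x in S, G (circleMap 0 1 θ • x) = ∫ x in S, G x := by
    intro θ
    have := (hmp θ).setIntegral_preimage_emb (hemb θ) G S
    rwa [hpre θ] at this
  have hrotn : ∀ θ : ℝ, ∫ x in S, ‖G (circleMap 0 1 θ • x)‖ = ∫ x in S, ‖G x‖ := by
    intro θ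
    have := (hmp θ).setIntegral_preimage_emb (hemb θ) (fun x => ‖G x‖) S
    rwa [hpre θ] at this
  have hroti : ∀ θ : ℝ, IntegrableOn (fun x => G (circleMap 0 1 θ • x)) S := by
    intro θ
    have := ((hmp θ).integrableOn_comp_preimage (hemb θ) (f := G) (s := S)).2 hint
    rwa [hpre θ] at this
  have hcont : ContinuousOn (Function.uncurry fun (θ : ℝ) (x : E) => G (circleMap 0 1 θ • x))
      (Set.univ ×ˢ S) := by
    refine hG.comp (t := S) ?_ ?_
    · exact Continuous.continuousOn (by fun_prop)
    · rintro ⟨θ, x⟩ ⟨-, hx⟩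
      exact hinv _ (hn θ) x hx
  have hmeas : AEStronglyMeasurable
      (Function.uncurry fun (θ : ℝ) (x : E) => G (circleMap 0 1 θ • x))
      ((volume.restrict (Set.uIoc 0 (2 * Real.pi))).prod (volume.restrict S)) := by
    rw [Measure.prod_restrict]
    exact (hcont.mono (Set.prod_mono_left (Set.subset_univ _))).aestronglyMeasurable
      (measurableSet_uIoc.prod hS.measurableSet)
  -- Fubini applies because the integral of the norm over `S` does not depend on the angle.
  have hswap : Integrable (Function.uncurry fun (θ : ℝ) (x : E) => G (circleMap 0 1 θ • x))
      ((volume.restrict (Set.uIoc 0 (2 * Real.pi))).prod (volume.restrict S)) := by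
    rw [integrable_prod_iff hmeas]
    refine ⟨Eventually.of_forall hroti, ?_⟩
    simp only [Function.uncurry_apply_pair, hrotn]
    exact integrableOn_const (by rw [Set.uIoc]; exact measure_Ioc_lt_top.ne)
  simp only [Real.circleAverage_def]
  rw [integral_smul, ← intervalIntegral_integral_swap hswap]
  simp only [hrot]
  rw [intervalIntegral.integral_const, smul_smul, sub_zero,
    inv_mul_cancel₀ Real.two_pi_pos.ne', one_smul]

/-- The mean value property of holomorphic functions on balls. -/
theorem setIntegral_ball_of_differentiableOn {F : E → ℂ} {p : E} {r : ℝ}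
    (hF : DifferentiableOn ℂ F (ball p r)) (hint : IntegrableOn F (ball p r)) :
    ∫ x in ball p r, F x = (volume : Measure E).real (ball 0 r) • F p := by
  have hpre : (fun x : E => p + x) ⁻¹' ball p r = ball 0 r := by
    ext x
    simp
  have hmp : MeasurePreserving (fun x : E => p + x) volume volume :=
    measurePreserving_add_left volume p
  have hemb : MeasurableEmbedding (fun x : E => p + x) := measurableEmbedding_addLeft p
  have h1 := hmp.setIntegral_preimage_emb hemb F (ball p r)
  have h2 := (hmp.integrableOn_comp_preimage hemb (f := F) (s := ball p r)).2 hint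
  rw [hpre] at h1 h2
  rw [← h1, setIntegral_eq_setIntegral_circleAverage (G := fun x => F (p + x)) isOpen_ball
    (fun c hc x hx => ?_) (hF.continuousOn.comp (by fun_prop) fun x hx => ?_) h2]
  · rw [setIntegral_congr_fun measurableSet_ball
      (fun x hx => circleAverage_add_smul_of_ball_subset hF hx), setIntegral_const]
  · simpa [norm_smul, hc] using hx
  · simpa using hx

/-- By the mean value property the volume of the ball times `f p` is the inner product of `f` with
the indicator of the ball; Cauchy–Schwarz bounds it. The constant depends on `r` only, so the bound
is locally uniform in `p`. -/
theorem norm_holomorphicRep_le (f : BergmanSpace Ω) {p : E} {r : ℝ} (hr : 0 < r)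
    (hp : ball p r ⊆ Ω) :
    ‖holomorphicRep f p‖ ≤ (volume : Measure E).real (ball 0 r) ^ (1 / 2 : ℝ) /
      (volume : Measure E).real (ball 0 r) * ‖f‖ := by
  set V := (volume : Measure E).real (ball 0 r) with hV
  have hVpos : 0 < V := ENNReal.toReal_pos (measure_ball_pos _ _ hr).ne' measure_ball_lt_top.ne
  have hrestr : ((volume : Measure E).restrict Ω).restrict (ball p r) =
      volume.restrict (ball p r) := by
    rw [Measure.restrict_restrict measurableSet_ball, Set.inter_eq_left.2 hp]
  have hfin : ((volume : Measure E).restrict Ω) (ball p r) ≠ ⊤ := by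
    rw [Measure.restrict_apply measurableSet_ball, Set.inter_eq_left.2 hp]
    exact measure_ball_lt_top.ne
  have hreal : ((volume : Measure E).restrict Ω).real (ball p r) = V := by
    rw [hV, measureReal_def, measureReal_def, Measure.restrict_apply measurableSet_ball,
      Set.inter_eq_left.2 hp, Measure.addHaar_ball_center]
  have hint : IntegrableOn (holomorphicRep f) (ball p r) := by
    have h := (holomorphicRep_memLp f).restrict (ball p r)
    rw [hrestr] at h
    have : IsFiniteMeasure ((volume : Measure E).restrict (ball p r)) :=
      ⟨by rw [Measure.restrict_apply_univ]; exact measure_ball_lt_top⟩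
    exact h.integrable one_le_two
  have h1 := setIntegral_ball_of_differentiableOn
    ((holomorphicRep_differentiableOn f).mono hp) hint
  have h2 := L2.inner_indicatorConstLp_one (𝕜 := ℂ) measurableSet_ball hfin
    (f : Lp ℂ 2 ((volume : Measure E).restrict Ω))
  rw [integral_congr_ae (ae_restrict_of_ae (coeFn_ae_eq_holomorphicRep f)), hrestr, h1] at h2
  have h3 := norm_inner_le_norm (𝕜 := ℂ) (indicatorConstLp 2 measurableSet_ball hfin (1 : ℂ))
    (f : Lp ℂ 2 ((volume : Measure E).restrict Ω))
  rw [h2, norm_indicatorConstLp two_ne_zero ENNReal.ofNat_ne_top, hreal, norm_smul,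
    Real.norm_of_nonneg hVpos.le, norm_one, one_mul, ENNReal.toReal_ofNat] at h3
  rw [div_mul_eq_mul_div, le_div_iff₀ hVpos, mul_comm]
  exact h3

/-- Evaluation at a point, as a bounded functional on the Bergman space. -/
noncomputable def bergmanEval (hΩ : IsOpen Ω) {p : E} (hp : p ∈ Ω) : BergmanSpace Ω →L[ℂ] ℂ :=
  LinearMap.mkContinuousOfExistsBound
    { toFun := fun f => holomorphicRep f p
      map_add' := fun f g => holomorphicRep_eqOn hΩ (f + g)
        ((holomorphicRep_differentiableOn f).continuousOn.add
          (holomorphicRep_differentiableOn g).continuousOn)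
        ((Lp.coeFn_add _ _).trans
          ((coeFn_ae_eq_holomorphicRep f).add (coeFn_ae_eq_holomorphicRep g))) hp
      map_smul' := fun c f => holomorphicRep_eqOn hΩ (c • f)
        ((holomorphicRep_differentiableOn f).continuousOn.const_smul c)
        ((Lp.coeFn_smul _ _).trans ((coeFn_ae_eq_holomorphicRep f).const_smul c)) hp }
    (by
      obtain ⟨r, hr, h⟩ := Metric.isOpen_iff.1 hΩ p hp
      exact ⟨_, fun f => norm_holomorphicRep_le f hr h⟩)

theorem bergmanEval_apply (hΩ : IsOpen Ω) {p : E} (hp : p ∈ Ω) (f : BergmanSpace Ω) :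
    bergmanEval hΩ hp f = holomorphicRep f p := rfl

/-- An `L²`-convergent sequence is Cauchy under point evaluations, uniformly near each point, so the
representatives converge to a holomorphic function. A subsequence converging almost everywhere
identifies it with the `L²` limit. -/
theorem isClosed_bergmanSpace (hΩ : IsOpen Ω) :
    IsClosed (BergmanSpace Ω : Set (Lp ℂ 2 ((volume : Measure E).restrict Ω))) := by
  refine IsSeqClosed.isClosed fun f g hf hfg => ?_
  let F : ℕ → BergmanSpace Ω := fun n => ⟨f n, hf n⟩
  have hcF : CauchySeq F := by
    have := hfg.cauchySeq
    rwa [Metric.cauchySeq_iff] at this ⊢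
  have hex : ∀ p : E, ∃ z : ℂ, p ∈ Ω →
      Tendsto (fun n => holomorphicRep (F n) p) atTop (𝓝 z) := by
    intro p
    by_cases hp : p ∈ Ω
    · obtain ⟨z, hz⟩ := cauchySeq_tendsto_of_complete
        ((bergmanEval hΩ hp).uniformContinuous.comp_cauchySeq hcF)
      exact ⟨z, fun _ => hz⟩
    · exact ⟨0, fun h => absurd h hp⟩
  choose G hG using hex
  refine ⟨G, fun p hp => ?_, ?_⟩
  · obtain ⟨R, hR, hRΩ⟩ := Metric.isOpen_iff.1 hΩ p hp
    obtain ⟨r, hr, rfl⟩ : ∃ r > 0, R = r + r := ⟨R / 2, by positivity, by ring⟩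
    have hsub : ∀ q ∈ ball p r, ball q r ⊆ Ω := fun q hq =>
      (ball_subset_ball' (by linarith [mem_ball.1 hq])).trans hRΩ
    have hunif : UniformCauchySeqOn (fun n => holomorphicRep (F n)) atTop (ball p r) := by
      rw [Metric.uniformCauchySeqOn_iff]
      intro ε hε
      set C := (volume : Measure E).real (ball 0 r) ^ (1 / 2 : ℝ) /
        (volume : Measure E).real (ball 0 r)
      have hC : 0 ≤ C := by positivity
      obtain ⟨N, hN⟩ := Metric.cauchySeq_iff.1 hcF (ε / (C + 1)) (by positivity)
      refine ⟨N, fun m hm n hn q hq => ?_⟩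
      have hqΩ : q ∈ Ω := hsub q hq (mem_ball_self hr)
      rw [dist_eq_norm, ← bergmanEval_apply hΩ hqΩ, ← bergmanEval_apply hΩ hqΩ, ← map_sub]
      have h1 := norm_holomorphicRep_le (F m - F n) hr (hsub q hq)
      have h2 := hN m hm n hn
      rw [dist_eq_norm, lt_div_iff₀ (by positivity)] at h2
      refine lt_of_le_of_lt h1 ?_
      nlinarith [norm_nonneg (F m - F n)]
    have := (hunif.tendstoUniformlyOn_of_tendsto fun q hq =>
      hG q (hsub q hq (mem_ball_self hr))).differentiableOn_complex isOpen_ball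
      fun n => (holomorphicRep_differentiableOn (F n)).mono
        fun q hq => hsub q hq (mem_ball_self hr)
    exact (this.differentiableAt (isOpen_ball.mem_nhds (mem_ball_self hr))).differentiableWithinAt
  · obtain ⟨ns, hns, hae⟩ := (tendstoInMeasure_of_tendsto_Lp hfg).exists_seq_tendsto_ae
    have hall : ∀ᵐ x ∂(volume : Measure E).restrict Ω, ∀ n, f n x = holomorphicRep (F n) x :=
      ae_all_iff.2 fun n => coeFn_ae_eq_holomorphicRep (F n)
    filter_upwards [hae, hall, ae_restrict_mem hΩ.measurableSet] with x h1 h2 hx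
    refine tendsto_nhds_unique h1 ?_
    simp only [h2]
    exact (hG x hx).comp hns.tendsto_atTop

theorem completeSpace_bergmanSpace (hΩ : IsOpen Ω) : CompleteSpace (BergmanSpace Ω) :=
  (isClosed_bergmanSpace hΩ).completeSpace_coe

/-- The sum `∑ⱼ |φⱼ(p)|²` does not depend on the orthonormal basis. -/
theorem hasSum_norm_holomorphicRep_sq (hΩ : IsOpen Ω) {J : Type*}
    (φ : HilbertBasis J ℂ (BergmanSpace Ω)) {p : E} (hp : p ∈ Ω) :
    HasSum (fun j => ‖holomorphicRep (φ j) p‖ ^ 2) (‖bergmanEval hΩ hp‖ ^ 2) := by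
  have := completeSpace_bergmanSpace hΩ
  -- `k` is the reproducing kernel at `p`; Parseval's identity for `⟨k, k⟩` gives a sum that depends
  -- on the evaluation functional only.
  set k := (InnerProductSpace.toDual ℂ (BergmanSpace Ω)).symm (bergmanEval hΩ hp) with hk
  have h := φ.hasSum_inner_mul_inner k k
  have hkk : inner ℂ k k = ((‖bergmanEval hΩ hp‖ ^ 2 : ℝ) : ℂ) := by
    have := inner_self_eq_norm_sq_to_K (𝕜 := ℂ) k
    rw [this, hk, LinearIsometryEquiv.norm_map]
    norm_cast
  have hterm : ∀ j, inner ℂ k (φ j) * inner ℂ (φ j) k =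
      ((‖holomorphicRep (φ j) p‖ ^ 2 : ℝ) : ℂ) := by
    intro j
    have h1 : inner ℂ k (φ j) = holomorphicRep (φ j) p := by
      rw [hk, InnerProductSpace.toDual_symm_apply, bergmanEval_apply]
    rw [← inner_conj_symm (φ j) k, h1, Complex.mul_conj, Complex.normSq_eq_norm_sq]
  rw [hkk] at h
  simp only [hterm] at h
  exact_mod_cast h

theorem bergmanKernel_eq_of_hilbertBasis (hΩ : IsOpen Ω) {J J' : Type*}
    (φ : HilbertBasis J ℂ (BergmanSpace Ω)) (ψ : HilbertBasis J' ℂ (BergmanSpace Ω)) {p : E}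
    (hp : p ∈ Ω) : bergmanKernel φ p = bergmanKernel ψ p :=
  (hasSum_norm_holomorphicRep_sq hΩ φ hp).tsum_eq.trans
    (hasSum_norm_holomorphicRep_sq hΩ ψ hp).tsum_eq.symm

end Bergman

/-! ### The monomials on the domain -/

section Monomials

open Metric Filter Topology

variable {n : ℕ}

theorem mem_hartogsDomain {p : (Fin n → ℂ) × ℂ} :
    p ∈ hartogsDomain n ↔ ‖p.2‖ ^ 2 < Real.exp (-∑ i, ‖p.1 i‖ ^ 2) := Iff.rfl

theorem isOpen_hartogsDomain (n : ℕ) : IsOpen (hartogsDomain n) :=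
  isOpen_lt (by fun_prop) (by fun_prop)

theorem isCompleteReinhardt_hartogsDomain (n : ℕ) : IsCompleteReinhardt (hartogsDomain n) := by
  intro p hp c d hc hd
  rw [mem_hartogsDomain] at hp ⊢
  have h1 : ∀ i, ‖c i * p.1 i‖ ^ 2 ≤ ‖p.1 i‖ ^ 2 := fun i => by
    rw [norm_mul]
    gcongr
    exact mul_le_of_le_one_left (norm_nonneg _) (hc i)
  have h2 : ‖d * p.2‖ ^ 2 ≤ ‖p.2‖ ^ 2 := by
    rw [norm_mul]
    gcongr
    exact mul_le_of_le_one_left (norm_nonneg _) hd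
  refine h2.trans_lt (hp.trans_le (Real.exp_le_exp.2 (neg_le_neg ?_)))
  exact Finset.sum_le_sum fun i _ => h1 i

theorem smul_mem_hartogsDomain {c : ℂ} (hc : ‖c‖ ≤ 1) {p : (Fin n → ℂ) × ℂ}
    (hp : p ∈ hartogsDomain n) : c • p ∈ hartogsDomain n :=
  isCompleteReinhardt_hartogsDomain n p hp (fun _ => c) c (fun _ => hc) hc

theorem mk_mem_hartogsDomain {z : Fin n → ℂ} {w : ℂ} :
    (z, w) ∈ hartogsDomain n ↔ w ∈ ball (0 : ℂ) (Real.exp (-(∑ i, ‖z i‖ ^ 2) / 2)) := by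
  rw [mem_hartogsDomain, mem_ball_zero_iff]
  have h : Real.exp (-∑ i, ‖z i‖ ^ 2) = Real.exp (-(∑ i, ‖z i‖ ^ 2) / 2) ^ 2 := by
    rw [← Real.exp_nat_mul]
    congr 1
    push_cast
    ring
  rw [h]
  exact pow_lt_pow_iff_left₀ (norm_nonneg _) (Real.exp_nonneg _) two_ne_zero

theorem differentiable_hartogsMonomial (α : Fin n → ℕ) (q : ℕ) :
    Differentiable ℂ (hartogsMonomial α q) := by
  unfold hartogsMonomial
  fun_prop

theorem norm_hartogsMonomial_sq (α : Fin n → ℕ) (q : ℕ) (p : (Fin n → ℂ) × ℂ) :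
    ‖hartogsMonomial α q p‖ ^ 2 = (∏ i, ‖p.1 i‖ ^ (2 * α i)) * ‖p.2‖ ^ (2 * q) := by
  simp only [hartogsMonomial, norm_mul, norm_prod, norm_pow, mul_pow, ← Finset.prod_pow, ← pow_mul]
  simp only [mul_comm]

theorem integral_ball_norm_pow (q : ℕ) {R : ℝ} (hR : 0 ≤ R) :
    ∫ w in ball (0 : ℂ) R, ‖w‖ ^ (2 * q) = Real.pi * R ^ (2 * q + 2) / (q + 1) := by
  rw [← integral_indicator measurableSet_ball]
  have h : (ball (0 : ℂ) R).indicator (fun w => ‖w‖ ^ (2 * q)) =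
      fun w => (Set.Iio R).indicator (fun y : ℝ => y ^ (2 * q)) ‖w‖ := by
    ext w
    by_cases hw : ‖w‖ < R <;> simp [Set.indicator, hw]
  rw [h, integral_fun_norm_addHaar volume, Complex.finrank_real_complex]
  have hvol : (volume : Measure ℂ).real (ball 0 1) = Real.pi := by
    simp [measureReal_def, Complex.volume_ball]
  have h2 : ∀ y : ℝ, y ^ (2 - 1) • (Set.Iio R).indicator (fun y : ℝ => y ^ (2 * q)) y =
      (Set.Iio R).indicator (fun y : ℝ => y ^ (2 * q + 1)) y := by
    intro y
    by_cases hy : y < R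
    · simp [Set.indicator, hy, pow_succ, mul_comm]
    · simp [Set.indicator, hy]
  simp only [h2]
  rw [setIntegral_indicator measurableSet_Iio, Set.Ioi_inter_Iio, ← integral_Ioc_eq_integral_Ioo,
    ← intervalIntegral.integral_of_le hR, integral_pow, hvol]
  simp only [smul_eq_mul, nsmul_eq_mul]
  push_cast
  field_simp
  ring

theorem integral_norm_pow_mul_gaussian (a : ℕ) {b : ℝ} (hb : 0 < b) :
    ∫ z : ℂ, ‖z‖ ^ (2 * a) * Real.exp (-b * ‖z‖ ^ 2) = Real.pi * a.factorial / b ^ (a + 1) := by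
  have h := Complex.integral_rpow_mul_exp_neg_mul_rpow (p := 2) (q := (2 * a : ℕ)) (b := b)
    (by norm_num) (by have : (0 : ℝ) ≤ (2 * a : ℕ) := Nat.cast_nonneg _
                      linarith) hb
  simp only [Real.rpow_natCast, Real.rpow_two] at h
  rw [h]
  have h1 : (((2 * a : ℕ) : ℝ) + 2) / 2 = (a : ℝ) + 1 := by
    push_cast
    ring
  rw [neg_div, h1, Real.Gamma_nat_eq_factorial, Real.rpow_neg hb.le]
  rw [show (a : ℝ) + 1 = ((a + 1 : ℕ) : ℝ) by push_cast; ring, Real.rpow_natCast]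
  field_simp

theorem integrable_norm_pow_mul_gaussian (a : ℕ) {b : ℝ} (hb : 0 < b) :
    Integrable fun z : ℂ => ‖z‖ ^ (2 * a) * Real.exp (-b * ‖z‖ ^ 2) := by
  -- The Bochner integral of a non-integrable function is `0` by convention, so a nonzero value
  -- certifies integrability.
  refine not_imp_comm.1 integral_undef ?_
  rw [integral_norm_pow_mul_gaussian a hb]
  positivity

theorem indicator_hartogsDomain_mk (f : (Fin n → ℂ) × ℂ → ℝ) (z : Fin n → ℂ) (w : ℂ) :
    (hartogsDomain n).indicator f (z, w) =
      (ball (0 : ℂ) (Real.exp (-(∑ i, ‖z i‖ ^ 2) / 2))).indicator (fun w => f (z, w)) w := by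
  by_cases hw : (z, w) ∈ hartogsDomain n
  · rw [Set.indicator_of_mem hw, Set.indicator_of_mem (mk_mem_hartogsDomain.1 hw)]
  · rw [Set.indicator_of_notMem hw, Set.indicator_of_notMem (mt mk_mem_hartogsDomain.2 hw)]

/-- The fibre over `z` is a disc of radius `R = exp(-|z|²/2)`, and `R^{2q+2} = exp(-(q+1)|z|²)` is a
product of one-variable Gaussians. The remaining integral over `z` therefore splits into
coordinates. -/
theorem integral_slice_hartogsMonomial (α : Fin n → ℕ) (q : ℕ) (z : Fin n → ℂ) :
    ∫ w, (hartogsDomain n).indicator (fun p => ‖hartogsMonomial α q p‖ ^ 2) (z, w) =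
      Real.pi / (q + 1) *
        ∏ i, (‖z i‖ ^ (2 * α i) * Real.exp (-((q : ℝ) + 1) * ‖z i‖ ^ 2)) := by
  have h : (fun w => (hartogsDomain n).indicator (fun p => ‖hartogsMonomial α q p‖ ^ 2) (z, w)) =
      (ball (0 : ℂ) (Real.exp (-(∑ i, ‖z i‖ ^ 2) / 2))).indicator
        (fun w => (∏ i, ‖z i‖ ^ (2 * α i)) * ‖w‖ ^ (2 * q)) := by
    ext w
    rw [indicator_hartogsDomain_mk]
    simp only [norm_hartogsMonomial_sq]
  rw [h, integral_indicator measurableSet_ball, integral_const_mul,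
    integral_ball_norm_pow q (Real.exp_nonneg _), Finset.prod_mul_distrib, ← Real.exp_sum,
    ← Real.exp_nat_mul, ← Finset.mul_sum]
  have : ((2 * q + 2 : ℕ) : ℝ) * (-(∑ i, ‖z i‖ ^ 2) / 2) =
      -((q : ℝ) + 1) * ∑ i, ‖z i‖ ^ 2 := by
    push_cast
    ring
  rw [this]
  ring

theorem integrableOn_norm_hartogsMonomial_sq (α : Fin n → ℕ) (q : ℕ) :
    IntegrableOn (fun p => ‖hartogsMonomial α q p‖ ^ 2) (hartogsDomain n) := by
  have hD := (isOpen_hartogsDomain n).measurableSet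
  have hcont := (differentiable_hartogsMonomial α q).continuous
  rw [← integrable_indicator_iff hD, Measure.volume_eq_prod]
  have hm : Measurable ((hartogsDomain n).indicator fun p => ‖hartogsMonomial α q p‖ ^ 2) :=
    (hcont.norm.pow 2).measurable.indicator hD
  rw [integrable_prod_iff hm.aestronglyMeasurable]
  refine ⟨Eventually.of_forall fun z => ?_, ?_⟩
  · simp only [indicator_hartogsDomain_mk]
    rw [integrable_indicator_iff measurableSet_ball]
    refine IntegrableOn.mono_set ?_ ball_subset_closedBall
    refine ContinuousOn.integrableOn_compact (isCompact_closedBall _ _) ?_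
    exact Continuous.continuousOn (by fun_prop)
  · have h : ∀ p, ‖(hartogsDomain n).indicator (fun p => ‖hartogsMonomial α q p‖ ^ 2) p‖ =
        (hartogsDomain n).indicator (fun p => ‖hartogsMonomial α q p‖ ^ 2) p := fun p =>
      Real.norm_of_nonneg (Set.indicator_nonneg (fun _ _ => by positivity) p)
    simp only [h, integral_slice_hartogsMonomial]
    refine Integrable.const_mul ?_ _
    exact Integrable.fintype_prod (f := fun i (x : ℂ) =>
      ‖x‖ ^ (2 * α i) * Real.exp (-((q : ℝ) + 1) * ‖x‖ ^ 2))
      fun i => integrable_norm_pow_mul_gaussian (α i) (by positivity)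

theorem memLp_hartogsMonomial (α : Fin n → ℕ) (q : ℕ) :
    MemLp (hartogsMonomial α q) 2 (volume.restrict (hartogsDomain n)) :=
  (memLp_two_iff_integrable_sq_norm
    (differentiable_hartogsMonomial α q).continuous.aestronglyMeasurable).2
    (integrableOn_norm_hartogsMonomial_sq α q)

theorem integral_norm_hartogsMonomial_sq (α : Fin n → ℕ) (q : ℕ) :
    ∫ p in hartogsDomain n, ‖hartogsMonomial α q p‖ ^ 2 = hartogsNormSq α q := by
  have hD := (isOpen_hartogsDomain n).measurableSet
  have hint := integrableOn_norm_hartogsMonomial_sq α q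
  rw [← integrable_indicator_iff hD, Measure.volume_eq_prod] at hint
  rw [← integral_indicator hD, Measure.volume_eq_prod, integral_prod _ hint]
  simp only [integral_slice_hartogsMonomial]
  have hq : (0 : ℝ) < (q : ℝ) + 1 := by positivity
  rw [integral_const_mul, integral_fintype_prod_volume_eq_prod (fun i (x : ℂ) =>
      ‖x‖ ^ (2 * α i) * Real.exp (-((q : ℝ) + 1) * ‖x‖ ^ 2)),
    Finset.prod_congr rfl fun i _ => integral_norm_pow_mul_gaussian (α i) hq,
    Finset.prod_div_distrib, Finset.prod_mul_distrib, Finset.prod_const, Finset.card_univ,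
    Fintype.card_fin, Finset.prod_pow_eq_pow_sum, Finset.sum_add_distrib, hartogsNormSq]
  simp only [Finset.sum_const, Finset.card_univ, Fintype.card_fin, smul_eq_mul, mul_one]
  field_simp
  ring

theorem hartogsNormSq_pos (α : Fin n → ℕ) (q : ℕ) : 0 < hartogsNormSq α q := by
  unfold hartogsNormSq
  have : ∀ i, (0 : ℝ) < ((α i).factorial : ℝ) := fun i => by positivity
  have := Finset.prod_pos fun i (_ : i ∈ Finset.univ) => this i
  positivity

theorem measurePreserving_torusAction {c : Fin n → ℂ} {d : ℂ} (hc : ∀ i, ‖c i‖ = 1)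
    (hd : ‖d‖ = 1) :
    MeasurePreserving (fun p : (Fin n → ℂ) × ℂ => ((fun i => c i * p.1 i, d * p.2) :
      (Fin n → ℂ) × ℂ)) volume volume := by
  have h1 : MeasurePreserving (fun z : Fin n → ℂ => fun i => c i * z i) volume volume :=
    measurePreserving_pi (fun _ => volume) (fun _ => volume)
      (f := fun i x => c i * x) fun i => measurePreserving_smul_of_norm_eq_one (hc i)
  exact h1.prod (measurePreserving_smul_of_norm_eq_one (E := ℂ) hd)

theorem setIntegral_torusAction {c : Fin n → ℂ} {d : ℂ} (hc : ∀ i, ‖c i‖ = 1)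
    (hd : ‖d‖ = 1) (f : (Fin n → ℂ) × ℂ → ℂ) :
    ∫ p in hartogsDomain n, f (fun i => c i * p.1 i, d * p.2) = ∫ p in hartogsDomain n, f p := by
  have hc0 : ∀ i, c i ≠ 0 := fun i => norm_ne_zero_iff.1 (by rw [hc i]; exact one_ne_zero)
  have hd0 : d ≠ 0 := norm_ne_zero_iff.1 (by rw [hd]; exact one_ne_zero)
  have hemb : MeasurableEmbedding (fun p : (Fin n → ℂ) × ℂ =>
      ((fun i => c i * p.1 i, d * p.2) : (Fin n → ℂ) × ℂ)) := by
    refine Continuous.measurableEmbedding (by fun_prop) fun p p' hpp' => ?_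
    simp only [Prod.mk.injEq] at hpp'
    refine Prod.ext (funext fun i => ?_) (mul_left_cancel₀ hd0 hpp'.2)
    exact mul_left_cancel₀ (hc0 i) (congrFun hpp'.1 i)
  have h := (measurePreserving_torusAction hc hd).setIntegral_preimage_emb hemb f (hartogsDomain n)
  have hpre : (fun p : (Fin n → ℂ) × ℂ => ((fun i => c i * p.1 i, d * p.2) :
      (Fin n → ℂ) × ℂ)) ⁻¹' hartogsDomain n = hartogsDomain n := by
    ext p
    simp [mem_hartogsDomain, hc, hd]
  rwa [hpre] at h

/-- Take `u = exp(iπ/(a - b))`, so that `u^{a-b} = -1`. A single sign-flipping rotation suffices for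
orthogonality, without averaging over the torus. -/
theorem exists_norm_eq_one_pow_mul_conj_pow {a b : ℕ} (h : a ≠ b) :
    ∃ u : ℂ, ‖u‖ = 1 ∧ u ^ a * (starRingEnd ℂ) u ^ b = -1 := by
  have hab : ((a : ℂ) - b) ≠ 0 := sub_ne_zero.2 (by exact_mod_cast h)
  refine ⟨Complex.exp ((Real.pi / ((a : ℝ) - b) : ℝ) * Complex.I), Complex.norm_exp_ofReal_mul_I _,
    ?_⟩
  rw [← Complex.exp_conj, ← Complex.exp_nat_mul, ← Complex.exp_nat_mul, ← Complex.exp_add,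
    ← Complex.exp_pi_mul_I]
  congr 1
  rw [map_mul, Complex.conj_ofReal, Complex.conj_I]
  push_cast
  field_simp
  ring

/-- Rotating one coordinate in which the exponents differ preserves the integral but changes the
sign of the integrand. -/
theorem integral_hartogsMonomial_mul_conj {α β : Fin n → ℕ} {q r : ℕ} (h : (α, q) ≠ (β, r)) :
    ∫ p in hartogsDomain n, hartogsMonomial α q p * (starRingEnd ℂ) (hartogsMonomial β r p) =
      0 := by
  obtain ⟨c, d, hc, hd, hcd⟩ : ∃ (c : Fin n → ℂ) (d : ℂ), (∀ i, ‖c i‖ = 1) ∧ ‖d‖ = 1 ∧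
      ((∏ i, c i ^ α i * (starRingEnd ℂ) (c i) ^ β i) * (d ^ q * (starRingEnd ℂ) d ^ r)) = -1 := by
    by_cases hαβ : α = β
    · have hqr : q ≠ r := fun h' => h (by rw [hαβ, h'])
      obtain ⟨u, hu, hu'⟩ := exists_norm_eq_one_pow_mul_conj_pow hqr
      exact ⟨fun _ => 1, u, by simp, hu, by simp [hu']⟩
    · obtain ⟨i, hi⟩ := Function.ne_iff.1 hαβ
      obtain ⟨u, hu, hu'⟩ := exists_norm_eq_one_pow_mul_conj_pow hi
      refine ⟨Function.update 1 i u, 1, fun j => ?_, by simp, ?_⟩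
      · by_cases hj : j = i
        · subst hj
          simp [hu]
        · simp [hj]
      · rw [Finset.prod_eq_single i]
        · simp [hu']
        · intro j _ hj
          simp [hj]
        · simp
  have key := setIntegral_torusAction hc hd
    (fun p => hartogsMonomial α q p * (starRingEnd ℂ) (hartogsMonomial β r p))
  have hterm : ∀ p : (Fin n → ℂ) × ℂ,
      hartogsMonomial α q (fun i => c i * p.1 i, d * p.2) *
        (starRingEnd ℂ) (hartogsMonomial β r (fun i => c i * p.1 i, d * p.2)) =
      -(hartogsMonomial α q p * (starRingEnd ℂ) (hartogsMonomial β r p)) := by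
    intro p
    rw [← neg_one_mul, ← hcd]
    simp only [hartogsMonomial, mul_pow, map_mul, map_prod, map_pow, Finset.prod_mul_distrib]
    ring
  simp only [hterm, integral_neg] at key
  exact self_eq_neg.1 key.symm

end Monomials

/-! ### Completeness of the monomials -/

section Completeness

open Metric Filter Topology

variable {n : ℕ}

instance isAddHaarMeasure_volume_hartogs (n : ℕ) :
    (volume : Measure ((Fin n → ℂ) × ℂ)).IsAddHaarMeasure :=
  have : (volume : Measure (Fin n → ℂ)).IsAddHaarMeasure :=
    inferInstanceAs (Measure.pi fun _ : Fin n => (volume : Measure ℂ)).IsAddHaarMeasure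
  Measure.prod.instIsAddHaarMeasure (volume : Measure (Fin n → ℂ)) (volume : Measure ℂ)

/-- The space of homogeneous polynomials of degree `m`, as functions on `ℂⁿ × ℂ`. -/
def homogeneousPolynomials (n m : ℕ) : Submodule ℂ ((Fin n → ℂ) × ℂ → ℂ) :=
  Submodule.span ℂ {f | ∃ (α : Fin n → ℕ) (q : ℕ), (∑ i, α i) + q = m ∧ f = hartogsMonomial α q}

theorem mul_fst_mem_homogeneousPolynomials {m : ℕ} {P : (Fin n → ℂ) × ℂ → ℂ}
    (hP : P ∈ homogeneousPolynomials n m) (i : Fin n) :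
    (fun x => x.1 i * P x) ∈ homogeneousPolynomials n (m + 1) := by
  induction hP using Submodule.span_induction with
  | mem f hf =>
    obtain ⟨α, q, hm, rfl⟩ := hf
    refine Submodule.subset_span ⟨α + Pi.single i 1, q, ?_, ?_⟩
    · simp only [Pi.add_apply, Finset.sum_add_distrib, Finset.sum_pi_single', Finset.mem_univ,
        if_true]
      omega
    · ext x
      have h : ∏ j, x.1 j ^ (Pi.single i 1 : Fin n → ℕ) j = x.1 i := by
        rw [Finset.prod_eq_single i] <;> simp +contextual
      simp only [hartogsMonomial, Pi.add_apply, pow_add, Finset.prod_mul_distrib, h]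
      ring
  | zero =>
    simp only [Pi.zero_apply, mul_zero]
    exact Submodule.zero_mem _
  | add f g _ _ hf hg =>
    simp only [Pi.add_apply, mul_add]
    exact Submodule.add_mem _ hf hg
  | smul a f _ hf =>
    convert! Submodule.smul_mem _ a hf using 1
    ext x
    simp only [Pi.smul_apply, smul_eq_mul]
    ring

theorem mul_snd_mem_homogeneousPolynomials {m : ℕ} {P : (Fin n → ℂ) × ℂ → ℂ}
    (hP : P ∈ homogeneousPolynomials n m) :
    (fun x => x.2 * P x) ∈ homogeneousPolynomials n (m + 1) := by
  induction hP using Submodule.span_induction with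
  | mem f hf =>
    obtain ⟨α, q, hm, rfl⟩ := hf
    refine Submodule.subset_span ⟨α, q + 1, by omega, ?_⟩
    ext x
    simp only [hartogsMonomial]
    ring
  | zero =>
    simp only [Pi.zero_apply, mul_zero]
    exact Submodule.zero_mem _
  | add f g _ _ hf hg =>
    simp only [Pi.add_apply, mul_add]
    exact Submodule.add_mem _ hf hg
  | smul a f _ hf =>
    convert! Submodule.smul_mem _ a hf using 1
    ext x
    simp only [Pi.smul_apply, smul_eq_mul]
    ring

theorem apply_smul_of_mem_homogeneousPolynomials {m : ℕ} {P : (Fin n → ℂ) × ℂ → ℂ}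
    (hP : P ∈ homogeneousPolynomials n m) (c : ℂ) (x : (Fin n → ℂ) × ℂ) :
    P (c • x) = c ^ m * P x := by
  induction hP using Submodule.span_induction with
  | mem f hf =>
    obtain ⟨α, q, hm, rfl⟩ := hf
    simp only [hartogsMonomial, Prod.smul_fst, Prod.smul_snd, Pi.smul_apply, smul_eq_mul, mul_pow,
      Finset.prod_mul_distrib, Finset.prod_pow_eq_pow_sum, ← hm, pow_add]
    ring
  | zero => simp
  | add f g _ _ hf hg => simp only [Pi.add_apply, hf, hg, mul_add]
  | smul a f _ hf =>
    simp only [Pi.smul_apply, smul_eq_mul, hf]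
    ring

theorem continuous_of_mem_homogeneousPolynomials {m : ℕ} {P : (Fin n → ℂ) × ℂ → ℂ}
    (hP : P ∈ homogeneousPolynomials n m) : Continuous P := by
  induction hP using Submodule.span_induction with
  | mem f hf =>
    obtain ⟨α, q, hm, rfl⟩ := hf
    exact (differentiable_hartogsMonomial α q).continuous
  | zero => exact continuous_const
  | add f g _ _ hf hg => exact hf.add hg
  | smul a f _ hf => exact hf.const_smul a

theorem memLp_of_mem_homogeneousPolynomials {m : ℕ} {P : (Fin n → ℂ) × ℂ → ℂ}
    (hP : P ∈ homogeneousPolynomials n m) : MemLp P 2 (volume.restrict (hartogsDomain n)) := by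
  induction hP using Submodule.span_induction with
  | mem f hf =>
    obtain ⟨α, q, hm, rfl⟩ := hf
    exact memLp_hartogsMonomial α q
  | zero => exact MemLp.zero
  | add f g _ _ hf hg => exact hf.add hg
  | smul a f _ hf => exact hf.const_smul a

theorem memLp_conj {X : Type*} [MeasurableSpace X] {μ : Measure X} {P : X → ℂ}
    (hP : MemLp P 2 μ) : MemLp (fun x => (starRingEnd ℂ) (P x)) 2 μ := by
  exact hP.star

theorem integral_mul_conj_eq_zero_of_mem_homogeneousPolynomials {F : (Fin n → ℂ) × ℂ → ℂ}
    (hF : MemLp F 2 (volume.restrict (hartogsDomain n)))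
    (h : ∀ (α : Fin n → ℕ) (q : ℕ),
      ∫ p in hartogsDomain n, F p * (starRingEnd ℂ) (hartogsMonomial α q p) = 0)
    {m : ℕ} {P : (Fin n → ℂ) × ℂ → ℂ} (hP : P ∈ homogeneousPolynomials n m) :
    ∫ p in hartogsDomain n, F p * (starRingEnd ℂ) (P p) = 0 := by
  induction hP using Submodule.span_induction with
  | mem f hf =>
    obtain ⟨α, q, hm, rfl⟩ := hf
    exact h α q
  | zero => simp
  | add f g hf' hg' hf hg =>
    simp only [Pi.add_apply, map_add, mul_add]
    refine (integral_add
      (hF.integrable_mul (memLp_conj (memLp_of_mem_homogeneousPolynomials hf')))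
      (hF.integrable_mul (memLp_conj (memLp_of_mem_homogeneousPolynomials hg')))).trans ?_
    simp only [Pi.mul_apply, hf, hg, add_zero]
  | smul a f _ hf =>
    have h' : ∀ p, F p * (starRingEnd ℂ) ((a • f) p) =
        (starRingEnd ℂ) a * (F p * (starRingEnd ℂ) (f p)) := fun p => by
      rw [Pi.smul_apply, smul_eq_mul, map_mul]
      ring
    simp only [h', integral_const_mul, hf, mul_zero]

theorem differentiableOn_comp_smul {E : Type*} [NormedAddCommGroup E] [NormedSpace ℂ E]
    {F : E → ℂ} {U : Set E} (hF : DifferentiableOn ℂ F U) (x : E) :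
    DifferentiableOn ℂ (fun c : ℂ => F (c • x)) {c | c • x ∈ U} :=
  hF.comp (by fun_prop) fun _ hc => hc

theorem contDiffAt_comp_smul {E : Type*} [NormedAddCommGroup E] [NormedSpace ℂ E]
    {F : E → ℂ} {U : Set E} (hU : IsOpen U) (h0 : (0 : E) ∈ U) (hF : DifferentiableOn ℂ F U)
    (x : E) (m : WithTop ℕ∞) : ContDiffAt ℂ m (fun c : ℂ => F (c • x)) 0 :=
  ((differentiableOn_comp_smul hF x).analyticAt
    ((hU.preimage (by fun_prop)).mem_nhds (by simpa using h0))).contDiffAt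

/-- The homogeneous components of a holomorphic function are homogeneous polynomials. -/
theorem iteratedDeriv_comp_smul_mem_homogeneousPolynomials {U : Set ((Fin n → ℂ) × ℂ)}
    (hU : IsOpen U) (h0 : (0 : (Fin n → ℂ) × ℂ) ∈ U) (m : ℕ) :
    ∀ {F : (Fin n → ℂ) × ℂ → ℂ}, DifferentiableOn ℂ F U →
      (fun x => iteratedDeriv m (fun c : ℂ => F (c • x)) 0) ∈ homogeneousPolynomials n m := by
  induction m with
  | zero =>
    intro F hF
    have h : (fun x : (Fin n → ℂ) × ℂ => iteratedDeriv 0 (fun c : ℂ => F (c • x)) 0) =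
        F 0 • hartogsMonomial 0 0 := by
      ext x
      simp [hartogsMonomial]
    rw [h]
    exact Submodule.smul_mem _ _ (Submodule.subset_span ⟨0, 0, by simp, rfl⟩)
  | succ m ih =>
    intro F hF
    let e : Fin n → (Fin n → ℂ) × ℂ := fun i => (Pi.single i 1, 0)
    have hd : ∀ v, DifferentiableOn ℂ (fun y => fderiv ℂ F y v) U := hF.fderiv_apply_complex hU
    -- By the chain rule, one derivative of `c ↦ F (c • x)` is the sum of the coordinates of `x`
    -- times the partial derivatives of `F` along the line. These are holomorphic, so the induction
    -- hypothesis applies to each.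
    have h : (fun x : (Fin n → ℂ) × ℂ => iteratedDeriv (m + 1) (fun c : ℂ => F (c • x)) 0) =
        (∑ i, fun x : (Fin n → ℂ) × ℂ => x.1 i *
          iteratedDeriv m (fun c : ℂ => fderiv ℂ F (c • x) (e i)) 0) +
        fun x : (Fin n → ℂ) × ℂ => x.2 *
          iteratedDeriv m (fun c : ℂ => fderiv ℂ F (c • x) (0, 1)) 0 := by
      ext x
      have hx : x = (∑ i, x.1 i • e i) + x.2 • ((0, 1) : (Fin n → ℂ) × ℂ) := by
        refine Prod.ext ?_ ?_
        · ext j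
          simp [e, Prod.fst_sum, Finset.sum_apply, Pi.single_apply]
        · simp [e, Prod.snd_sum]
      have hev : deriv (fun c : ℂ => F (c • x)) =ᶠ[𝓝 0] fun c : ℂ =>
          (∑ i, x.1 i * fderiv ℂ F (c • x) (e i)) + x.2 * fderiv ℂ F (c • x) (0, 1) := by
        have hmem : {c : ℂ | c • x ∈ U} ∈ 𝓝 (0 : ℂ) :=
          (hU.preimage (by fun_prop)).mem_nhds (by simpa using h0)
        filter_upwards [hmem] with c hc
        have h1 : HasDerivAt (fun c : ℂ => F (c • x)) (fderiv ℂ F (c • x) x) c := by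
          have h2 : HasDerivAt (fun c : ℂ => c • x) x c := by
            simpa using (hasDerivAt_id c).smul_const x
          exact (hF.differentiableAt (hU.mem_nhds hc)).hasFDerivAt.comp_hasDerivAt c h2
        rw [h1.deriv]
        conv_lhs => rw [hx]
        rw [map_add, map_sum, map_smul, smul_eq_mul, ← hx]
        simp only [map_smul, smul_eq_mul]
      have hcd : ∀ v, ContDiffAt ℂ m (fun c : ℂ => fderiv ℂ F (c • x) v) 0 := fun v =>
        contDiffAt_comp_smul hU h0 (hd v) x m
      rw [iteratedDeriv_succ', hev.iteratedDeriv_eq]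
      have hsum : (fun c : ℂ => (∑ i, x.1 i * fderiv ℂ F (c • x) (e i)) +
          x.2 * fderiv ℂ F (c • x) (0, 1)) =
          (fun c : ℂ => ∑ i, x.1 i * fderiv ℂ F (c • x) (e i)) +
            fun c : ℂ => x.2 * fderiv ℂ F (c • x) (0, 1) := rfl
      rw [hsum, iteratedDeriv_add (ContDiffAt.sum fun i _ => contDiffAt_const.mul (hcd _))
        (contDiffAt_const.mul (hcd _)), iteratedDeriv_fun_sum
        fun i _ => contDiffAt_const.mul (hcd _)]
      simp only [Pi.add_apply, Finset.sum_apply]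
      congr 1
      · exact Finset.sum_congr rfl fun i _ => iteratedDeriv_const_mul _ (hcd _)
      · exact iteratedDeriv_const_mul _ (hcd _)
    rw [h]
    refine Submodule.add_mem _ (Submodule.sum_mem _ fun i _ => ?_) ?_
    · exact mul_fst_mem_homogeneousPolynomials (ih (hd (e i))) i
    · exact mul_snd_mem_homogeneousPolynomials (ih (hd (0, 1)))

/-- The Fourier coefficients of a holomorphic function on a circle. -/
theorem circleAverage_mul_conj_pow {g : ℂ → ℂ} (hg : DifferentiableOn ℂ g (closedBall 0 1))
    (m : ℕ) :
    Real.circleAverage (fun c => g c * (starRingEnd ℂ) (c ^ m)) 0 1 =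
      iteratedDeriv m g 0 / m.factorial := by
  have h := hg.circleIntegral_one_div_sub_center_pow_smul one_pos m
  rw [Real.circleAverage_eq_circleIntegral one_ne_zero]
  -- On the unit circle `conj z = z⁻¹`, so the Fourier coefficient is the Cauchy integral for the
  -- `m`-th derivative.
  have h2 : ∮ z in C(0, 1), (z - 0)⁻¹ • (g z * (starRingEnd ℂ) (z ^ m)) =
      ∮ z in C(0, 1), (1 / (z - 0) ^ (m + 1)) • g z := by
    refine circleIntegral.integral_congr zero_le_one fun z hz => ?_
    have hz1 : ‖z‖ = 1 := by simpa using hz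
    have hinv : (starRingEnd ℂ) z = z⁻¹ := (Complex.inv_eq_conj hz1).symm
    simp only [sub_zero, smul_eq_mul, map_pow, hinv, one_div, pow_succ, mul_inv, inv_pow]
    ring
  rw [h2, h, smul_smul, smul_eq_mul]
  have := Complex.two_pi_I_ne_zero
  field_simp

theorem zero_mem_hartogsDomain (n : ℕ) : (0 : (Fin n → ℂ) × ℂ) ∈ hartogsDomain n := by
  simp [mem_hartogsDomain]

/-- Let `P` be the `m`-th derivative at `0` of `c ↦ F (c • x)`, a homogeneous polynomial in `x`,
hence orthogonal to `F`. Averaging `F * conj P` over circle orbits gives `|P|² / m!`, so `P` has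
zero `L²` norm and vanishes on `D`. All Taylor coefficients of `F` along lines through `0` are then
zero. -/
theorem eqOn_zero_of_orthogonal_hartogsMonomial {F : (Fin n → ℂ) × ℂ → ℂ}
    (hd : DifferentiableOn ℂ F (hartogsDomain n))
    (hF : MemLp F 2 (volume.restrict (hartogsDomain n)))
    (h : ∀ (α : Fin n → ℕ) (q : ℕ),
      ∫ p in hartogsDomain n, F p * (starRingEnd ℂ) (hartogsMonomial α q p) = 0) :
    Set.EqOn F 0 (hartogsDomain n) := by
  have hDo := isOpen_hartogsDomain n
  have hdisc : ∀ x ∈ hartogsDomain n,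
      DifferentiableOn ℂ (fun c : ℂ => F (c • x)) (closedBall 0 1) := fun x hx =>
    (differentiableOn_comp_smul hd x).mono fun c hc =>
      smul_mem_hartogsDomain (mem_closedBall_zero_iff.1 hc) hx
  have hP : ∀ m, ∀ x ∈ hartogsDomain n, iteratedDeriv m (fun c : ℂ => F (c • x)) 0 = 0 := by
    intro m
    set P : (Fin n → ℂ) × ℂ → ℂ := fun x => iteratedDeriv m (fun c : ℂ => F (c • x)) 0 with hPdef
    have hPm : P ∈ homogeneousPolynomials n m :=
      iteratedDeriv_comp_smul_mem_homogeneousPolynomials hDo (zero_mem_hartogsDomain n) m hd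
    have hPc := continuous_of_mem_homogeneousPolynomials hPm
    have h1 := integral_mul_conj_eq_zero_of_mem_homogeneousPolynomials hF h hPm
    rw [setIntegral_eq_setIntegral_circleAverage
      (G := fun p => F p * (starRingEnd ℂ) (P p)) hDo
      (fun c hc x hx => smul_mem_hartogsDomain hc.le hx)
      (hd.continuousOn.mul (Complex.continuous_conj.comp hPc).continuousOn)
      (hF.integrable_mul (memLp_conj (memLp_of_mem_homogeneousPolynomials hPm)))] at h1
    have h2 : ∀ x ∈ hartogsDomain n,
        Real.circleAverage (fun c : ℂ => F (c • x) * (starRingEnd ℂ) (P (c • x))) 0 1 =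
          ((‖P x‖ ^ 2 / m.factorial : ℝ) : ℂ) := by
      intro x hx
      have h3 : (fun c : ℂ => F (c • x) * (starRingEnd ℂ) (P (c • x))) =
          fun c : ℂ => ((starRingEnd ℂ) (P x)) • (F (c • x) * (starRingEnd ℂ) (c ^ m)) := by
        ext c
        rw [apply_smul_of_mem_homogeneousPolynomials hPm, map_mul, smul_eq_mul]
        ring
      rw [h3, Real.circleAverage_fun_smul, circleAverage_mul_conj_pow (hdisc x hx), smul_eq_mul,
        ← mul_div_assoc, mul_comm, Complex.mul_conj, Complex.normSq_eq_norm_sq]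
      push_cast
      rfl
    rw [setIntegral_congr_fun hDo.measurableSet h2, integral_complex_ofReal,
      Complex.ofReal_eq_zero, integral_div, div_eq_zero_iff] at h1
    have h4 : ∫ x in hartogsDomain n, ‖P x‖ ^ 2 = 0 :=
      h1.resolve_right (by exact_mod_cast m.factorial_ne_zero)
    rw [integral_eq_zero_iff_of_nonneg (fun x => by positivity)
      ((memLp_two_iff_integrable_sq_norm hPc.aestronglyMeasurable).1
        (memLp_of_mem_homogeneousPolynomials hPm))] at h4
    have h5 := Measure.eqOn_open_of_ae_eq h4 hDo (hPc.norm.pow 2).continuousOn continuousOn_const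
    intro x hx
    simpa using h5 hx
  intro x hx
  -- The Taylor series is available only on the open unit disc, so `x` is written as `t⁻¹ • (t • x)`
  -- with `t > 1` and `t • x` still in the domain.
  have hnear : ∀ᶠ t : ℝ in 𝓝 1, (t : ℂ) • x ∈ hartogsDomain n := by
    have hc : Continuous fun t : ℝ => (t : ℂ) • x := by fun_prop
    exact hc.continuousAt.eventually_mem (hDo.mem_nhds (by simpa using hx))
  obtain ⟨t, ht, ht1⟩ := ((hnear.filter_mono nhdsWithin_le_nhds).and
    (self_mem_nhdsWithin : Set.Ioi (1 : ℝ) ∈ 𝓝[>] 1)).exists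
  have ht1 : 1 < t := ht1
  have ht0 : (t : ℂ) ≠ 0 := by exact_mod_cast (by linarith : t ≠ 0)
  have hs := Complex.hasSum_taylorSeries_on_ball ((hdisc _ ht).mono ball_subset_closedBall)
    (z := (t : ℂ)⁻¹) (by
      rw [mem_ball_zero_iff, norm_inv, Complex.norm_real, Real.norm_of_nonneg (by linarith)]
      exact inv_lt_one_of_one_lt₀ ht1)
  simp only [hP _ _ ht, smul_zero] at hs
  rw [smul_smul, inv_mul_cancel₀ ht0, one_smul] at hs
  exact hs.unique hasSum_zero

/-- The normalized monomials, as elements of the Bergman space. -/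
noncomputable def normalizedMonomial (i : (Fin n → ℕ) × ℕ) : BergmanSpace (hartogsDomain n) :=
  ⟨((memLp_hartogsMonomial i.1 i.2).const_smul
      ((Real.sqrt (hartogsNormSq i.1 i.2) : ℂ)⁻¹)).toLp _,
    (Real.sqrt (hartogsNormSq i.1 i.2) : ℂ)⁻¹ • hartogsMonomial i.1 i.2,
    (differentiable_hartogsMonomial i.1 i.2).differentiableOn.const_smul _, MemLp.coeFn_toLp _⟩

theorem holomorphicRep_normalizedMonomial (i : (Fin n → ℕ) × ℕ) :
    Set.EqOn (holomorphicRep (normalizedMonomial i))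
      (fun p => hartogsMonomial i.1 i.2 p / (Real.sqrt (hartogsNormSq i.1 i.2) : ℂ))
      (hartogsDomain n) := by
  have hc := (differentiable_hartogsMonomial i.1 i.2).continuous
  refine holomorphicRep_eqOn (isOpen_hartogsDomain n) _ (by fun_prop) ?_
  refine (MemLp.coeFn_toLp ((memLp_hartogsMonomial i.1 i.2).const_smul
    ((Real.sqrt (hartogsNormSq i.1 i.2) : ℂ)⁻¹))).trans (Eventually.of_forall fun p => ?_)
  simp only [Pi.smul_apply, smul_eq_mul, div_eq_inv_mul]

theorem inner_bergmanSpace {E : Type*} [NormedAddCommGroup E] [NormedSpace ℂ E] [MeasureSpace E]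
    {Ω : Set E} (f g : BergmanSpace Ω) :
    inner ℂ f g = ∫ x in Ω, holomorphicRep g x * (starRingEnd ℂ) (holomorphicRep f x) := by
  rw [Submodule.coe_inner, L2.inner_def]
  refine integral_congr_ae ?_
  filter_upwards [coeFn_ae_eq_holomorphicRep f, coeFn_ae_eq_holomorphicRep g] with x h1 h2
  rw [h1, h2, RCLike.inner_apply]

theorem orthonormal_normalizedMonomial :
    Orthonormal ℂ (normalizedMonomial : (Fin n → ℕ) × ℕ → BergmanSpace (hartogsDomain n)) := by
  classical
  rw [orthonormal_iff_ite]
  rintro ⟨α, q⟩ ⟨β, r⟩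
  have hcongr : ∀ p ∈ hartogsDomain n,
      holomorphicRep (normalizedMonomial (β, r)) p *
        (starRingEnd ℂ) (holomorphicRep (normalizedMonomial (α, q)) p) =
      ((Real.sqrt (hartogsNormSq β r) : ℂ)⁻¹ * (Real.sqrt (hartogsNormSq α q) : ℂ)⁻¹) *
        (hartogsMonomial β r p * (starRingEnd ℂ) (hartogsMonomial α q p)) := by
    intro p hp
    rw [holomorphicRep_normalizedMonomial _ hp, holomorphicRep_normalizedMonomial _ hp, map_div₀,
      Complex.conj_ofReal]
    ring
  rw [inner_bergmanSpace, setIntegral_congr_fun (isOpen_hartogsDomain n).measurableSet hcongr,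
    integral_const_mul]
  split_ifs with h
  · obtain ⟨rfl, rfl⟩ := Prod.mk.inj h
    have hn : ∀ p, hartogsMonomial α q p * (starRingEnd ℂ) (hartogsMonomial α q p) =
        ((‖hartogsMonomial α q p‖ ^ 2 : ℝ) : ℂ) := fun p => by
      rw [Complex.mul_conj, Complex.normSq_eq_norm_sq]
    simp only [hn]
    have hpos := hartogsNormSq_pos α q
    rw [integral_complex_ofReal, integral_norm_hartogsMonomial_sq]
    norm_cast
    rw [← mul_inv, Real.mul_self_sqrt hpos.le, inv_mul_cancel₀ hpos.ne']
  · rw [integral_hartogsMonomial_mul_conj fun h' => h h'.symm, mul_zero]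

theorem span_normalizedMonomial_orthogonal :
    (Submodule.span ℂ (Set.range
      (normalizedMonomial : (Fin n → ℕ) × ℕ → BergmanSpace (hartogsDomain n))))ᗮ = ⊥ := by
  rw [Submodule.eq_bot_iff]
  intro f hf
  have hD := isOpen_hartogsDomain n
  have hzero : Set.EqOn (holomorphicRep f) 0 (hartogsDomain n) := by
    refine eqOn_zero_of_orthogonal_hartogsMonomial (holomorphicRep_differentiableOn f)
      (holomorphicRep_memLp f) fun α q => ?_
    have h := (Submodule.mem_orthogonal _ f).1 hf (normalizedMonomial (α, q))
      (Submodule.subset_span ⟨_, rfl⟩)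
    have hcongr : ∀ p ∈ hartogsDomain n, holomorphicRep f p *
        (starRingEnd ℂ) (holomorphicRep (normalizedMonomial (α, q)) p) =
        (Real.sqrt (hartogsNormSq α q) : ℂ)⁻¹ *
          (holomorphicRep f p * (starRingEnd ℂ) (hartogsMonomial α q p)) := by
      intro p hp
      rw [holomorphicRep_normalizedMonomial _ hp, map_div₀, Complex.conj_ofReal]
      ring
    rw [inner_bergmanSpace, setIntegral_congr_fun hD.measurableSet hcongr,
      integral_const_mul] at h
    refine (mul_eq_zero.1 h).resolve_left (inv_ne_zero ?_)
    exact_mod_cast (Real.sqrt_pos.2 (hartogsNormSq_pos α q)).ne'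
  refine Subtype.ext (Lp.ext ?_)
  refine (coeFn_ae_eq_holomorphicRep f).trans ?_
  refine EventuallyEq.trans ?_ (Lp.coeFn_zero _ _ _).symm
  filter_upwards [ae_restrict_mem hD.measurableSet] with x hx
  exact hzero hx

/-- The normalized monomials as a Hilbert basis of the Bergman space. -/
noncomputable def monomialBasis (n : ℕ) :
    HilbertBasis ((Fin n → ℕ) × ℕ) ℂ (BergmanSpace (hartogsDomain n)) :=
  have := completeSpace_bergmanSpace (isOpen_hartogsDomain n)
  HilbertBasis.mkOfOrthogonalEqBot orthonormal_normalizedMonomial span_normalizedMonomial_orthogonal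

theorem holomorphicRep_monomialBasis (α : Fin n → ℕ) (q : ℕ) {p : (Fin n → ℂ) × ℂ}
    (hp : p ∈ hartogsDomain n) :
    holomorphicRep (monomialBasis n (α, q)) p =
      hartogsMonomial α q p / (Real.sqrt (hartogsNormSq α q) : ℂ) := by
  have := completeSpace_bergmanSpace (isOpen_hartogsDomain n)
  rw [monomialBasis, HilbertBasis.coe_mkOfOrthogonalEqBot]
  exact holomorphicRep_normalizedMonomial (α, q) hp

end Completeness

/-! ### The series `∑ (q + 1)^k t^q` -/

section SuccPowSeries

open Filter Topology

/-- The power series `∑ (q + 1)^k t^q`. -/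
noncomputable def succPowSeries (k : ℕ) (t : ℝ) : ℝ := ∑' q : ℕ, ((q : ℝ) + 1) ^ k * t ^ q

theorem summable_succPowSeries (k : ℕ) {t : ℝ} (ht : |t| < 1) :
    Summable fun q : ℕ => ((q : ℝ) + 1) ^ k * t ^ q := by
  by_cases h0 : t = 0
  · subst h0
    refine summable_of_ne_finset_zero (s := {0}) fun q hq => ?_
    rw [zero_pow (by simpa using hq), mul_zero]
  · have h := (summable_nat_add_iff 1).2
      (summable_pow_mul_geometric_of_norm_lt_one k (r := t) (by simpa using ht))
    refine (h.mul_left t⁻¹).congr fun q => ?_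
    rw [pow_succ]
    push_cast
    field_simp

theorem hasSum_succPowSeries (k : ℕ) {t : ℝ} (ht : |t| < 1) :
    HasSum (fun q : ℕ => ((q : ℝ) + 1) ^ k * t ^ q) (succPowSeries k t) :=
  (summable_succPowSeries k ht).hasSum

theorem succPowSeries_zero_right (k : ℕ) : succPowSeries k 0 = 1 := by
  rw [succPowSeries, tsum_eq_single 0]
  · simp
  · intro q hq
    simp [hq]

theorem succPowSeries_zero_left {t : ℝ} (ht : |t| < 1) : succPowSeries 0 t = (1 - t)⁻¹ := by
  simp [succPowSeries, tsum_geometric_of_abs_lt_one ht]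

theorem succPowSeries_pos (k : ℕ) {t : ℝ} (h0 : 0 ≤ t) (h1 : t < 1) : 0 < succPowSeries k t :=
  (summable_succPowSeries k (by rwa [abs_of_nonneg h0])).tsum_pos (fun q => by positivity) 0
    (by simp)

/-- The operator `d/dt ∘ t` multiplies the coefficient of `t^q` by `q + 1`, hence raises `k` by one.
Differentiation term by term is dominated by the series at a radius between `|t|` and `1`. -/
theorem hasDerivAt_mul_succPowSeries (k : ℕ) {t : ℝ} (ht : |t| < 1) :
    HasDerivAt (fun y => y * succPowSeries k y) (succPowSeries (k + 1) t) t := by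
  obtain ⟨r, hr1, hr2⟩ := exists_between ht
  have hr0 : 0 ≤ r := (abs_nonneg t).trans hr1.le
  have h := hasDerivAt_tsum_of_isPreconnected (t := Set.Ioo (-r) r) (y₀ := t) (y := t)
    (g := fun q : ℕ => fun y : ℝ => ((q : ℝ) + 1) ^ k * y ^ (q + 1))
    (g' := fun q : ℕ => fun y : ℝ => ((q : ℝ) + 1) ^ (k + 1) * y ^ q)
    (summable_succPowSeries (k + 1) (t := r) (by rwa [abs_of_nonneg hr0]))
    isOpen_Ioo isPreconnected_Ioo (fun q y _ => ?_) (fun q y hy => ?_) (abs_lt.1 hr1) ?_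
    (abs_lt.1 hr1)
  · convert! h using 1
    ext y
    rw [succPowSeries, ← tsum_mul_left]
    exact tsum_congr fun q => by ring
  · convert! (hasDerivAt_pow (q + 1) y).const_mul (((q : ℝ) + 1) ^ k) using 1
    push_cast
    ring
  · rw [norm_mul, norm_pow, norm_pow, Real.norm_of_nonneg (by positivity : (0 : ℝ) ≤ (q : ℝ) + 1)]
    gcongr
    exact (abs_lt.2 hy).le
  · refine ((summable_succPowSeries k ht).mul_left t).congr fun q => ?_
    ring

/-- Induction from the geometric series, through the operator `d/dt ∘ t`. -/
theorem contDiffOn_succPowSeries (k : ℕ) : ContDiffOn ℝ ∞ (succPowSeries k) (Set.Ioo (-1) 1) := by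
  induction k with
  | zero =>
    have h : ContDiffOn ℝ ∞ (fun t : ℝ => (1 - t)⁻¹) (Set.Ioo (-1) 1) :=
      (contDiff_const.sub contDiff_id).contDiffOn.inv fun t ht => by
        simp only [id]
        linarith [ht.2]
    exact h.congr fun t ht => succPowSeries_zero_left (abs_lt.2 ht)
  | succ k ih =>
    have h : ContDiffOn ℝ ∞ (deriv fun y => y * succPowSeries k y) (Set.Ioo (-1) 1) :=
      (contDiffOn_id.mul ih).deriv_of_isOpen isOpen_Ioo (by simp)
    exact h.congr fun t ht => (hasDerivAt_mul_succPowSeries k (abs_lt.2 ht)).deriv.symm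

theorem hasDerivAt_succPowSeries (k : ℕ) {t : ℝ} (ht : |t| < 1) :
    HasDerivAt (succPowSeries k) (deriv (succPowSeries k) t) t :=
  (((contDiffOn_succPowSeries k).contDiffAt (Ioo_mem_nhds (abs_lt.1 ht).1
    (abs_lt.1 ht).2)).differentiableAt (by simp)).hasDerivAt

theorem hasDerivAt_deriv_succPowSeries (k : ℕ) {t : ℝ} (ht : |t| < 1) :
    HasDerivAt (deriv (succPowSeries k)) (deriv (deriv (succPowSeries k)) t) t := by
  have h : ContDiffOn ℝ ∞ (deriv (succPowSeries k)) (Set.Ioo (-1) 1) :=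
    (contDiffOn_succPowSeries k).deriv_of_isOpen isOpen_Ioo (by simp)
  exact ((h.contDiffAt (Ioo_mem_nhds (abs_lt.1 ht).1
    (abs_lt.1 ht).2)).differentiableAt (by simp)).hasDerivAt

theorem succPowSeries_add_mul_deriv (k : ℕ) {t : ℝ} (ht : |t| < 1) :
    succPowSeries k t + t * deriv (succPowSeries k) t = succPowSeries (k + 1) t := by
  have h := (hasDerivAt_id t).mul (hasDerivAt_succPowSeries k ht)
  have := h.unique (hasDerivAt_mul_succPowSeries k ht)
  simpa using this

/-- The value is the coefficient of `t`. Differentiating `S_{k+1} = S_k + t S_k'` at `0` doubles it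
at each step. -/
theorem deriv_succPowSeries_zero (k : ℕ) : deriv (succPowSeries k) 0 = 2 ^ k := by
  have hnear : ∀ᶠ t : ℝ in 𝓝 0, |t| < 1 := by
    have := Ioo_mem_nhds (a := (-1 : ℝ)) (b := 1) (x := 0) (by norm_num) (by norm_num)
    filter_upwards [this] with t ht using abs_lt.2 ht
  induction k with
  | zero =>
    have h : succPowSeries 0 =ᶠ[𝓝 0] fun t => (1 - t)⁻¹ := by
      filter_upwards [hnear] with t ht using succPowSeries_zero_left ht
    rw [h.deriv_eq]
    have h2 : HasDerivAt (fun t : ℝ => (1 - t)⁻¹) (-(-1) / (1 - 0) ^ 2) 0 :=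
      ((hasDerivAt_id (0 : ℝ)).const_sub 1).inv (by norm_num)
    rw [h2.deriv]
    norm_num
  | succ k ih =>
    have h : succPowSeries (k + 1) =ᶠ[𝓝 0]
        fun t => succPowSeries k t + t * deriv (succPowSeries k) t := by
      filter_upwards [hnear] with t ht using (succPowSeries_add_mul_deriv k ht).symm
    rw [h.deriv_eq]
    have h2 := (hasDerivAt_succPowSeries k (t := 0) (by simp)).add
      ((hasDerivAt_id (0 : ℝ)).mul (hasDerivAt_deriv_succPowSeries k (t := 0) (by simp)))
    refine h2.deriv.trans ?_
    simp only [id, one_mul, zero_mul, add_zero, ih]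
    ring

/-- Strict log-convexity of the series. -/
theorem sq_succPowSeries_lt (k : ℕ) {t : ℝ} (h0 : 0 < t) (h1 : t < 1) :
    succPowSeries (k + 1) t ^ 2 < succPowSeries (k + 2) t * succPowSeries k t := by
  have ht : |t| < 1 := by rwa [abs_of_pos h0]
  have hpos := succPowSeries_pos k h0.le h1
  -- `μ` is the mean of `q + 1` under the weights `(q + 1)^k t^q`; the inequality says that the
  -- variance is positive.
  set μ := succPowSeries (k + 1) t / succPowSeries k t with hμ
  have hs : HasSum (fun q : ℕ => ((q : ℝ) + 1) ^ k * t ^ q * ((q : ℝ) + 1 - μ) ^ 2)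
      (succPowSeries (k + 2) t - 2 * μ * succPowSeries (k + 1) t + μ ^ 2 * succPowSeries k t) := by
    convert! ((hasSum_succPowSeries (k + 2) ht).sub
      ((hasSum_succPowSeries (k + 1) ht).mul_left (2 * μ))).add
      ((hasSum_succPowSeries k ht).mul_left (μ ^ 2)) using 1
    ext q
    ring
  have hp : 0 < succPowSeries (k + 2) t - 2 * μ * succPowSeries (k + 1) t +
      μ ^ 2 * succPowSeries k t := by
    rw [← hs.tsum_eq]
    -- One nonzero term is enough: `q = 0` contributes unless `μ = 1`, and then `q = 1` does.
    by_cases h : μ = 1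
    · refine hs.summable.tsum_pos (fun q => by positivity) 1 ?_
      rw [h]
      push_cast
      positivity
    · refine hs.summable.tsum_pos (fun q => by positivity) 0 ?_
      have : (1 - μ) ≠ 0 := sub_ne_zero.2 (Ne.symm h)
      simp only [Nat.cast_zero, zero_add, one_pow, pow_zero, one_mul]
      positivity
  have hμ' : μ * succPowSeries k t = succPowSeries (k + 1) t := div_mul_cancel₀ _ hpos.ne'
  have := mul_pos hp hpos
  nlinarith

/-- The derivative of the quotient `succPowSeries (k + 1) / succPowSeries k`. -/
noncomputable def succPowSlope (k : ℕ) (t : ℝ) : ℝ :=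
  (deriv (succPowSeries (k + 1)) t * succPowSeries k t -
    succPowSeries (k + 1) t * deriv (succPowSeries k) t) / succPowSeries k t ^ 2

/-- For `t > 0`, `t` times the numerator is `S_{k+2} S_k - S_{k+1}²`, positive by log-convexity. At
`t = 0` this degenerates, and the numerator is `2^{k+1} - 2^k` directly. -/
theorem succPowSlope_pos (k : ℕ) {t : ℝ} (h0 : 0 ≤ t) (h1 : t < 1) : 0 < succPowSlope k t := by
  have hpos := succPowSeries_pos k h0 h1
  refine div_pos ?_ (by positivity)
  rcases h0.eq_or_lt with rfl | h0
  · rw [deriv_succPowSeries_zero, deriv_succPowSeries_zero, succPowSeries_zero_right,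
      succPowSeries_zero_right, pow_succ]
    have : (0 : ℝ) < 2 ^ k := by positivity
    linarith
  · have ht : |t| < 1 := by rwa [abs_of_pos h0]
    refine pos_of_mul_pos_right (a := t) ?_ h0.le
    have e1 := succPowSeries_add_mul_deriv k ht
    have e2 := succPowSeries_add_mul_deriv (k + 1) ht
    have h := sq_succPowSeries_lt k h0 h1
    have e3 : t * (deriv (succPowSeries (k + 1)) t * succPowSeries k t -
        succPowSeries (k + 1) t * deriv (succPowSeries k) t) =
        succPowSeries (k + 2) t * succPowSeries k t - succPowSeries (k + 1) t ^ 2 := by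
      have e1' : t * deriv (succPowSeries k) t = succPowSeries (k + 1) t - succPowSeries k t := by
        linarith
      have e2' : t * deriv (succPowSeries (k + 1)) t =
          succPowSeries (k + 2) t - succPowSeries (k + 1) t := by linarith
      calc _ = (t * deriv (succPowSeries (k + 1)) t) * succPowSeries k t -
          succPowSeries (k + 1) t * (t * deriv (succPowSeries k) t) := by ring
        _ = _ := by rw [e1', e2']; ring
    rw [e3]
    linarith

/-- The logarithmic derivative of the series. -/
noncomputable def succPowLogDeriv (k : ℕ) (t : ℝ) : ℝ :=
  deriv (succPowSeries k) t / succPowSeries k t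

theorem hasDerivAt_log_succPowSeries (k : ℕ) {t : ℝ} (h0 : 0 ≤ t) (h1 : t < 1) :
    HasDerivAt (fun y => Real.log (succPowSeries k y)) (succPowLogDeriv k t) t :=
  (hasDerivAt_succPowSeries k (by rwa [abs_of_nonneg h0])).log (succPowSeries_pos k h0 h1).ne'

theorem one_add_mul_succPowLogDeriv (k : ℕ) {t : ℝ} (h0 : 0 ≤ t) (h1 : t < 1) :
    1 + t * succPowLogDeriv k t = succPowSeries (k + 1) t / succPowSeries k t := by
  have hpos := succPowSeries_pos k h0 h1
  rw [← succPowSeries_add_mul_deriv k (by rwa [abs_of_nonneg h0]), succPowLogDeriv]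
  field_simp

/-- With `L` the logarithmic derivative, `L + t L'` is the derivative of `1 + t L = S_{k+1}/S_k`.
The complex Hessian of `log K` involves only these two combinations. -/
theorem exists_hasDerivAt_succPowLogDeriv (k : ℕ) {t : ℝ} (h0 : 0 ≤ t) (h1 : t < 1) :
    ∃ L₂, HasDerivAt (succPowLogDeriv k) L₂ t ∧
      succPowLogDeriv k t + t * L₂ = succPowSlope k t := by
  have ht : |t| < 1 := by rwa [abs_of_nonneg h0]
  have hpos := succPowSeries_pos k h0 h1
  have hd := (hasDerivAt_deriv_succPowSeries k ht).div (hasDerivAt_succPowSeries k ht) hpos.ne'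
  refine ⟨_, hd, ?_⟩
  have h1' : HasDerivAt (fun y => 1 + y * succPowLogDeriv k y) _ t :=
    ((hasDerivAt_id t).mul hd).const_add 1
  have h2 : HasDerivAt (fun y => succPowSeries (k + 1) y / succPowSeries k y)
      (succPowSlope k t) t :=
    (hasDerivAt_succPowSeries (k + 1) ht).div (hasDerivAt_succPowSeries k ht) hpos.ne'
  have hev : (fun y => 1 + y * succPowLogDeriv k y) =ᶠ[𝓝 t]
      fun y => succPowSeries (k + 1) y / succPowSeries k y := by
    have hc := (hasDerivAt_succPowSeries k ht).continuousAt.eventually_ne hpos.ne'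
    filter_upwards [hc, Ioo_mem_nhds (abs_lt.1 ht).1 (abs_lt.1 ht).2] with y hy hy'
    rw [← succPowSeries_add_mul_deriv k (abs_lt.2 hy'), succPowLogDeriv]
    field_simp
  have := h1'.unique (h2.congr_of_eventuallyEq hev)
  rw [← this]
  simp [succPowLogDeriv]

end SuccPowSeries

/-! ### The Bergman kernel -/

section Kernel

open Filter Topology

variable {n : ℕ}

theorem hasSum_pi_prod {n : ℕ} {f : Fin n → ℕ → ℝ} {a : Fin n → ℝ} (hf : ∀ i k, 0 ≤ f i k)
    (h : ∀ i, HasSum (f i) (a i)) :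
    HasSum (fun α : Fin n → ℕ => ∏ i, f i (α i)) (∏ i, a i) := by
  induction n with
  | zero =>
    simp only [Finset.univ_eq_empty, Finset.prod_empty]
    convert! hasSum_unique (fun _ : Fin 0 → ℕ => (1 : ℝ)) using 1
  | succ n ih =>
    have ih' := ih (f := fun i => f i.succ) (fun i k => hf i.succ k) fun i => h i.succ
    have hs := (h 0).summable.mul_of_nonneg ih'.summable (hf 0)
      fun α => Finset.prod_nonneg fun i _ => hf i.succ (α i)
    rw [Fin.prod_univ_succ]
    refine ((Fin.consEquiv fun _ : Fin (n + 1) => ℕ).hasSum_iff.1 ?_)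
    convert! (h 0).mul ih' hs using 1
    ext ⟨k, α⟩
    simp [Fin.consEquiv, Fin.prod_univ_succ]

/-- The function `|w|² exp |z|²`, which is less than one exactly on the domain. -/
noncomputable def hartogsDefining (p : (Fin n → ℂ) × ℂ) : ℝ :=
  ‖p.2‖ ^ 2 * Real.exp (∑ i, ‖p.1 i‖ ^ 2)

theorem hartogsDefining_nonneg (p : (Fin n → ℂ) × ℂ) : 0 ≤ hartogsDefining p := by
  unfold hartogsDefining
  positivity

theorem mem_hartogsDomain_iff {p : (Fin n → ℂ) × ℂ} :
    p ∈ hartogsDomain n ↔ hartogsDefining p < 1 := by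
  rw [mem_hartogsDomain, hartogsDefining, Real.exp_neg, ← one_div, lt_div_iff₀ (Real.exp_pos _)]

theorem contDiff_hartogsDefining : ContDiff ℝ ∞ (hartogsDefining (n := n)) := by
  unfold hartogsDefining
  have h1 : ∀ i, ContDiff ℝ ∞ fun p : (Fin n → ℂ) × ℂ => ‖p.1 i‖ ^ 2 := fun i =>
    ContDiff.norm_sq ℝ (by fun_prop)
  have h2 : ContDiff ℝ ∞ fun p : (Fin n → ℂ) × ℂ => ‖p.2‖ ^ 2 :=
    ContDiff.norm_sq ℝ (by fun_prop)
  fun_prop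

theorem norm_holomorphicRep_monomialBasis_sq (α : Fin n → ℕ) (q : ℕ) {p : (Fin n → ℂ) × ℂ}
    (hp : p ∈ hartogsDomain n) :
    ‖holomorphicRep (monomialBasis n (α, q)) p‖ ^ 2 =
      (((q : ℝ) + 1) ^ (n + 1) * ‖p.2‖ ^ (2 * q) / Real.pi ^ (n + 1)) *
        ∏ i, (((q : ℝ) + 1) * ‖p.1 i‖ ^ 2) ^ α i / ((α i).factorial : ℝ) := by
  rw [holomorphicRep_monomialBasis α q hp, norm_div, div_pow, norm_hartogsMonomial_sq,
    Complex.norm_real, Real.norm_of_nonneg (Real.sqrt_nonneg _),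
    Real.sq_sqrt (hartogsNormSq_pos α q).le, hartogsNormSq, Finset.prod_div_distrib]
  simp only [mul_pow, Finset.prod_mul_distrib, Finset.prod_pow_eq_pow_sum, ← pow_mul, pow_add]
  have : (∏ i, ((α i).factorial : ℝ)) ≠ 0 :=
    Finset.prod_ne_zero_iff.2 fun i _ => by positivity
  field_simp

/-- For fixed `q` the sum over `α` is a product of exponential series with value `exp((q+1)|z|²)`;
together with `|w|^{2q}` this is `exp(|z|²) t^q`, and the sum over `q` is `S_{n+1}(t)`. -/
theorem bergmanKernel_monomialBasis {p : (Fin n → ℂ) × ℂ} (hp : p ∈ hartogsDomain n) :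
    bergmanKernel (monomialBasis n) p = (Real.pi ^ (n + 1))⁻¹ *
      (Real.exp (∑ i, ‖p.1 i‖ ^ 2) * succPowSeries (n + 1) (hartogsDefining p)) := by
  have ht : |hartogsDefining p| < 1 := by
    rw [abs_of_nonneg (hartogsDefining_nonneg p)]
    exact mem_hartogsDomain_iff.1 hp
  have h1 := hasSum_norm_holomorphicRep_sq (isOpen_hartogsDomain n) (monomialBasis n) hp
  have h2 := (Equiv.prodComm ℕ (Fin n → ℕ)).hasSum_iff.2 h1
  have h3 := h2.prod_fiberwise (g := fun q : ℕ => (Real.pi ^ (n + 1))⁻¹ *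
    (Real.exp (∑ i, ‖p.1 i‖ ^ 2) * (((q : ℝ) + 1) ^ (n + 1) * hartogsDefining p ^ q)))
    fun q => ?_
  · have h4 := ((hasSum_succPowSeries (n + 1) ht).mul_left
      (Real.exp (∑ i, ‖p.1 i‖ ^ 2))).mul_left (Real.pi ^ (n + 1))⁻¹
    rw [bergmanKernel, h1.tsum_eq, h3.unique h4]
  · have h5 := hasSum_pi_prod
      (f := fun i k => (((q : ℝ) + 1) * ‖p.1 i‖ ^ 2) ^ k / (k.factorial : ℝ))
      (a := fun i => Real.exp (((q : ℝ) + 1) * ‖p.1 i‖ ^ 2))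
      (fun i k => by positivity) fun i => by
        rw [Real.exp_eq_exp_ℝ]
        exact NormedSpace.expSeries_div_hasSum_exp _
    convert! h5.mul_left (((q : ℝ) + 1) ^ (n + 1) * ‖p.2‖ ^ (2 * q) / Real.pi ^ (n + 1)) using 1
    · ext α
      exact norm_holomorphicRep_monomialBasis_sq α q hp
    · rw [← Real.exp_sum, ← Finset.mul_sum, hartogsDefining, mul_pow, ← Real.exp_nat_mul, add_mul,
        Real.exp_add, one_mul, ← pow_mul]
      field_simp

theorem bergmanKernel_hartogsDomain {J : Type*}
    (φ : HilbertBasis J ℂ (BergmanSpace (hartogsDomain n))) {p : (Fin n → ℂ) × ℂ}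
    (hp : p ∈ hartogsDomain n) :
    bergmanKernel φ p = (Real.pi ^ (n + 1))⁻¹ *
      (Real.exp (∑ i, ‖p.1 i‖ ^ 2) * succPowSeries (n + 1) (hartogsDefining p)) :=
  (bergmanKernel_eq_of_hilbertBasis (isOpen_hartogsDomain n) φ (monomialBasis n) hp).trans
    (bergmanKernel_monomialBasis hp)

theorem bergmanKernel_hartogsDomain_pos {J : Type*}
    (φ : HilbertBasis J ℂ (BergmanSpace (hartogsDomain n))) {p : (Fin n → ℂ) × ℂ}
    (hp : p ∈ hartogsDomain n) : 0 < bergmanKernel φ p := by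
  rw [bergmanKernel_hartogsDomain φ hp]
  have := succPowSeries_pos (n + 1) (hartogsDefining_nonneg p) (mem_hartogsDomain_iff.1 hp)
  positivity

theorem contDiffOn_bergmanKernel_hartogsDomain {J : Type*}
    (φ : HilbertBasis J ℂ (BergmanSpace (hartogsDomain n))) :
    ContDiffOn ℝ ∞ (bergmanKernel φ) (hartogsDomain n) := by
  have h1 : ∀ i, ContDiff ℝ ∞ fun p : (Fin n → ℂ) × ℂ => ‖p.1 i‖ ^ 2 := fun i =>
    ContDiff.norm_sq ℝ (by fun_prop)
  have h2 : ContDiff ℝ ∞ fun p : (Fin n → ℂ) × ℂ => Real.exp (∑ i, ‖p.1 i‖ ^ 2) := by fun_prop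
  have h3 : ContDiffOn ℝ ∞ (fun p : (Fin n → ℂ) × ℂ => succPowSeries (n + 1) (hartogsDefining p))
      (hartogsDomain n) :=
    (contDiffOn_succPowSeries (n + 1)).comp contDiff_hartogsDefining.contDiffOn fun p hp =>
      ⟨by linarith [hartogsDefining_nonneg p], mem_hartogsDomain_iff.1 hp⟩
  exact (contDiffOn_const.mul (h2.contDiffOn.mul h3)).congr fun p hp =>
    bergmanKernel_hartogsDomain φ hp

theorem log_bergmanKernel_hartogsDomain {J : Type*}
    (φ : HilbertBasis J ℂ (BergmanSpace (hartogsDomain n))) {p : (Fin n → ℂ) × ℂ}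
    (hp : p ∈ hartogsDomain n) :
    Real.log (bergmanKernel φ p) = Real.log (Real.pi ^ (n + 1))⁻¹ +
      (∑ i, ‖p.1 i‖ ^ 2 + Real.log (succPowSeries (n + 1) (hartogsDefining p))) := by
  have := succPowSeries_pos (n + 1) (hartogsDefining_nonneg p) (mem_hartogsDomain_iff.1 hp)
  rw [bergmanKernel_hartogsDomain φ hp, Real.log_mul (by positivity) (by positivity),
    Real.log_mul (by positivity) (by positivity), Real.log_exp]

end Kernel

/-! ### The Bergman metric -/

section Hessian

open Filter Topology

theorem hasFDerivAt_apply_self {E : Type*} [NormedAddCommGroup E] [NormedSpace ℝ E]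
    {β : E →L[ℝ] E →L[ℝ] ℝ} (hβ : ∀ u v, β u v = β v u) (q : E) :
    HasFDerivAt (fun q => β q q) ((2 : ℝ) • β q) q := by
  have h := β.isBoundedBilinearMap.hasFDerivAt (q, q)
  have h2 := HasFDerivAt.comp (f := fun q : E => (q, q)) q h
    ((hasFDerivAt_id q).prodMk (hasFDerivAt_id q))
  refine h2.congr_fderiv ?_
  ext v
  simp [hβ v q, two_mul, IsBoundedBilinearMap.deriv]

/-- The second derivative of `q ↦ C + (β(q,q) + L(γ(q,q) exp β(q,q)))`. -/
theorem fderiv_fderiv_quadratic_add_comp {E : Type*} [NormedAddCommGroup E] [NormedSpace ℝ E]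
    {β γ : E →L[ℝ] E →L[ℝ] ℝ} (hβ : ∀ u v, β u v = β v u) (hγ : ∀ u v, γ u v = γ v u)
    {f : E → ℝ} {C : ℝ} {L L₁ : ℝ → ℝ} {L₂ : ℝ} {U : Set E} (hU : IsOpen U)
    (hf : ∀ q ∈ U, f q = C + (β q q + L (γ q q * Real.exp (β q q))))
    (hL : ∀ q ∈ U, HasDerivAt L (L₁ (γ q q * Real.exp (β q q))) (γ q q * Real.exp (β q q)))
    {p : E} (hp : p ∈ U) {e t l : ℝ} (he : e = Real.exp (β p p)) (ht : t = γ p p * e)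
    (hl : l = L₁ t) (hL₁ : HasDerivAt L₁ L₂ t) (u v : E) :
    fderiv ℝ (fderiv ℝ f) p u v =
      2 * (1 + t * l) * β u v + 4 * (l + t * L₂) * t * (β p u * β p v) +
      4 * (l + t * L₂) * e * (γ p u * β p v + β p u * γ p v) +
      4 * e ^ 2 * L₂ * (γ p u * γ p v) + 2 * e * l * γ u v := by
  have hb := fun q => hasFDerivAt_apply_self hβ q
  have hg := fun q => hasFDerivAt_apply_self hγ q
  have hexp := fun q => (hb q).exp
  have htd := fun q => (hg q).mul (hexp q)
  have h1 : ∀ q ∈ U, fderiv ℝ f q =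
      (1 + γ q q * Real.exp (β q q) * L₁ (γ q q * Real.exp (β q q))) • ((2 : ℝ) • β) q +
      (Real.exp (β q q) * L₁ (γ q q * Real.exp (β q q))) • ((2 : ℝ) • γ) q := by
    intro q hq
    have hev : f =ᶠ[𝓝 q] fun q => C + (β q q + L (γ q q * Real.exp (β q q))) := by
      filter_upwards [hU.mem_nhds hq] with y hy using hf y hy
    have h2 := ((hb q).add ((hL q hq).comp_hasFDerivAt q (htd q))).const_add C
    refine (hev.fderiv_eq.trans (HasFDerivAt.fderiv h2)).trans ?_
    ext w
    simp only [add_apply, smul_apply, smul_eq_mul]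
    ring
  have hev : fderiv ℝ f =ᶠ[𝓝 p] fun q =>
      (1 + γ q q * Real.exp (β q q) * L₁ (γ q q * Real.exp (β q q))) • ((2 : ℝ) • β) q +
      (Real.exp (β q q) * L₁ (γ q q * Real.exp (β q q))) • ((2 : ℝ) • γ) q := by
    filter_upwards [hU.mem_nhds hp] with y hy using h1 y hy
  have hL₁' : HasDerivAt L₁ L₂ (γ p p * Real.exp (β p p)) := by rwa [← he, ← ht]
  have hL₁c := hL₁'.comp_hasFDerivAt p (htd p)
  have h3 := ((((htd p).mul hL₁c).const_add 1).smul
      (((2 : ℝ) • β).hasFDerivAt (x := p))).add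
    (((hexp p).mul hL₁c).smul (((2 : ℝ) • γ).hasFDerivAt (x := p)))
  refine (congrArg (fun T : E →L[ℝ] E →L[ℝ] ℝ => T u v)
    (hev.fderiv_eq.trans (HasFDerivAt.fderiv h3))).trans ?_
  simp only [add_apply, smul_apply, smul_eq_mul, ContinuousLinearMap.smulRight_apply,
    Function.comp_apply, Pi.mul_apply, ← he, ← ht, ← hl]
  subst ht
  ring

end Hessian

/-! ### Closed form and positivity of the Bergman metric. -/

section Metric

open Filter Topology

variable {n : ℕ}

/-- The Hermitian product `∑ uᵢ v̄ᵢ` of the first components. -/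
noncomputable def baseHerm (u v : (Fin n → ℂ) × ℂ) : ℂ :=
  ∑ i, u.1 i * (starRingEnd ℂ) (v.1 i)

/-- The real inner product of the first components. -/
noncomputable def baseForm (n : ℕ) : ((Fin n → ℂ) × ℂ) →L[ℝ] ((Fin n → ℂ) × ℂ) →L[ℝ] ℝ :=
  ∑ i, (innerSL ℝ).bilinearComp
    ((ContinuousLinearMap.proj i).comp (ContinuousLinearMap.fst ℝ (Fin n → ℂ) ℂ))
    ((ContinuousLinearMap.proj i).comp (ContinuousLinearMap.fst ℝ (Fin n → ℂ) ℂ))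

/-- The real inner product of the last components. -/
noncomputable def fiberForm (n : ℕ) : ((Fin n → ℂ) × ℂ) →L[ℝ] ((Fin n → ℂ) × ℂ) →L[ℝ] ℝ :=
  (innerSL ℝ).bilinearComp (ContinuousLinearMap.snd ℝ (Fin n → ℂ) ℂ)
    (ContinuousLinearMap.snd ℝ (Fin n → ℂ) ℂ)

theorem baseForm_apply (u v : (Fin n → ℂ) × ℂ) : baseForm n u v = (baseHerm u v).re := by
  simp [baseForm, baseHerm, Complex.inner, mul_comm]

theorem fiberForm_apply (u v : (Fin n → ℂ) × ℂ) :
    fiberForm n u v = (u.2 * (starRingEnd ℂ) v.2).re := by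
  simp [fiberForm, Complex.inner, mul_comm]

theorem baseForm_self (p : (Fin n → ℂ) × ℂ) : baseForm n p p = ∑ i, ‖p.1 i‖ ^ 2 := by
  rw [baseForm_apply, baseHerm, Complex.re_sum]
  refine Finset.sum_congr rfl fun i _ => ?_
  rw [Complex.mul_conj, Complex.ofReal_re, Complex.normSq_eq_norm_sq]

theorem fiberForm_self (p : (Fin n → ℂ) × ℂ) : fiberForm n p p = ‖p.2‖ ^ 2 := by
  rw [fiberForm_apply, Complex.mul_conj, Complex.ofReal_re, Complex.normSq_eq_norm_sq]

theorem conj_baseHerm (u v : (Fin n → ℂ) × ℂ) : (starRingEnd ℂ) (baseHerm u v) = baseHerm v u := by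
  simp [baseHerm, mul_comm]

theorem mulI_apply (u : (Fin n → ℂ) × ℂ) : mulI ((Fin n → ℂ) × ℂ) u = Complex.I • u := rfl

theorem baseHerm_mulI_left (u v : (Fin n → ℂ) × ℂ) :
    baseHerm (Complex.I • u) v = Complex.I * baseHerm u v := by
  simp [baseHerm, Finset.mul_sum, mul_assoc]

theorem baseHerm_mulI_right (u v : (Fin n → ℂ) × ℂ) :
    baseHerm u (Complex.I • v) = -Complex.I * baseHerm u v := by
  simp only [baseHerm, Finset.mul_sum, Prod.smul_fst, Pi.smul_apply, smul_eq_mul, map_mul,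
    Complex.conj_I]
  exact Finset.sum_congr rfl fun i _ => by ring

theorem baseForm_comm (u v : (Fin n → ℂ) × ℂ) : baseForm n u v = baseForm n v u := by
  rw [baseForm_apply, baseForm_apply, ← conj_baseHerm, Complex.conj_re]

theorem fiberForm_comm (u v : (Fin n → ℂ) × ℂ) : fiberForm n u v = fiberForm n v u := by
  rw [fiberForm_apply, fiberForm_apply, ← Complex.conj_re, map_mul, Complex.conj_conj, mul_comm]

/-- The Bergman metric of the domain. -/
theorem bergmanMetric_hartogsDomain {J : Type*}
    (φ : HilbertBasis J ℂ (BergmanSpace (hartogsDomain n))) {p : (Fin n → ℂ) × ℂ}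
    (hp : p ∈ hartogsDomain n) (u v : (Fin n → ℂ) × ℂ) :
    bergmanMetric φ p u v =
      ((succPowSeries (n + 2) (hartogsDefining p) / succPowSeries (n + 1) (hartogsDefining p) :
        ℝ) : ℂ) * baseHerm u v +
      ((succPowSlope (n + 1) (hartogsDefining p) * Real.exp (∑ i, ‖p.1 i‖ ^ 2) : ℝ) : ℂ) *
        ((u.2 + p.2 * baseHerm u p) * (starRingEnd ℂ) (v.2 + p.2 * baseHerm v p)) := by
  have ht0 := hartogsDefining_nonneg p
  have ht1 := mem_hartogsDomain_iff.1 hp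
  obtain ⟨L₂, hL₂, hslope⟩ := exists_hasDerivAt_succPowLogDeriv (n + 1) ht0 ht1
  have hA := one_add_mul_succPowLogDeriv (n + 1) ht0 ht1
  have htq : ∀ q : (Fin n → ℂ) × ℂ,
      fiberForm n q q * Real.exp (baseForm n q q) = hartogsDefining q := fun q => by
    rw [fiberForm_self, baseForm_self, hartogsDefining]
  have hH := fderiv_fderiv_quadratic_add_comp (β := baseForm n) (γ := fiberForm n)
    (f := fun q => Real.log (bergmanKernel φ q))
    (L := fun y => Real.log (succPowSeries (n + 1) y)) (L₁ := succPowLogDeriv (n + 1))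
    baseForm_comm fiberForm_comm (isOpen_hartogsDomain n)
    (fun q hq => by rw [htq, baseForm_self, log_bergmanKernel_hartogsDomain φ hq])
    (fun q hq => by
      rw [htq]
      exact hasDerivAt_log_succPowSeries (n + 1) (hartogsDefining_nonneg q)
        (mem_hartogsDomain_iff.1 hq))
    hp rfl (htq p).symm rfl hL₂
  rw [← hA, ← hslope]
  simp only [bergmanMetric, complexHessian, mulI_apply]
  simp only [hH, baseForm_apply, fiberForm_apply, baseHerm_mulI_left, baseHerm_mulI_right,
    ← conj_baseHerm u p, ← conj_baseHerm v p]
  -- Once `t = |w|² e` is substituted, the claim is a polynomial identity in real and imaginary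
  -- parts, so the exponential, the logarithmic derivative and the Hermitian products can all be
  -- generalized to variables.
  have ht : hartogsDefining p = (p.2.re ^ 2 + p.2.im ^ 2) * Real.exp (baseHerm p p).re := by
    rw [← htq, fiberForm_self, baseForm_apply, ← Complex.normSq_eq_norm_sq, Complex.normSq_apply]
    ring
  have he : Real.exp (∑ i, ‖p.1 i‖ ^ 2) = Real.exp (baseHerm p p).re := by
    rw [← baseForm_self, baseForm_apply]
  rw [he]
  generalize succPowLogDeriv (n + 1) (hartogsDefining p) = l
  generalize Real.exp (baseHerm p p).re = e at ht
  rw [ht]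
  generalize baseHerm u p = a
  generalize baseHerm v p = b
  generalize baseHerm u v = c
  simp only [Prod.smul_snd, smul_eq_mul]
  generalize u.2 = s
  generalize v.2 = r
  generalize p.2 = w
  have h4 : (1 / 4 : ℂ) = ((1 / 4 : ℝ) : ℂ) := by norm_num
  rw [h4]
  apply Complex.ext <;>
  · simp only [Complex.add_re, Complex.add_im, Complex.mul_re, Complex.mul_im, Complex.ofReal_re,
      Complex.ofReal_im, Complex.I_re, Complex.I_im, Complex.conj_re, Complex.conj_im,
      Complex.neg_re, Complex.neg_im, map_add, map_mul, Complex.conj_I]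
    ring

theorem bergmanMetric_hartogsDomain_self {J : Type*}
    (φ : HilbertBasis J ℂ (BergmanSpace (hartogsDomain n))) {p : (Fin n → ℂ) × ℂ}
    (hp : p ∈ hartogsDomain n) (u : (Fin n → ℂ) × ℂ) :
    bergmanMetric φ p u u =
      ((succPowSeries (n + 2) (hartogsDefining p) / succPowSeries (n + 1) (hartogsDefining p) *
          ∑ i, ‖u.1 i‖ ^ 2 +
        succPowSlope (n + 1) (hartogsDefining p) * Real.exp (∑ i, ‖p.1 i‖ ^ 2) *
          ‖u.2 + p.2 * baseHerm u p‖ ^ 2 : ℝ) : ℂ) := by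
  have h : baseHerm u u = ((∑ i, ‖u.1 i‖ ^ 2 : ℝ) : ℂ) := by
    rw [baseHerm, Complex.ofReal_sum]
    refine Finset.sum_congr rfl fun i _ => ?_
    rw [Complex.mul_conj, Complex.normSq_eq_norm_sq]
  rw [bergmanMetric_hartogsDomain φ hp, h, Complex.mul_conj, Complex.normSq_eq_norm_sq]
  push_cast
  ring

/-- Both coefficients are positive. If `u.1 = 0`, the shift `p.2 * baseHerm u p` also vanishes and
the second square is `‖u.2‖²`; otherwise the first sum is positive. -/
theorem bergmanMetric_hartogsDomain_pos {J : Type*}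
    (φ : HilbertBasis J ℂ (BergmanSpace (hartogsDomain n))) {p : (Fin n → ℂ) × ℂ}
    (hp : p ∈ hartogsDomain n) {u : (Fin n → ℂ) × ℂ} (hu : u ≠ 0) :
    (bergmanMetric φ p u u).im = 0 ∧ 0 < (bergmanMetric φ p u u).re := by
  have ht0 := hartogsDefining_nonneg p
  have ht1 := mem_hartogsDomain_iff.1 hp
  rw [bergmanMetric_hartogsDomain_self φ hp]
  refine ⟨Complex.ofReal_im _, ?_⟩
  rw [Complex.ofReal_re]
  have h1 := div_pos (succPowSeries_pos (n + 2) ht0 ht1) (succPowSeries_pos (n + 1) ht0 ht1)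
  have h2 := mul_pos (succPowSlope_pos (n + 1) ht0 ht1) (Real.exp_pos (∑ i, ‖p.1 i‖ ^ 2))
  by_cases hu1 : u.1 = 0
  · have hu2 : u.2 ≠ 0 := fun h => hu (Prod.ext hu1 h)
    have h3 : baseHerm u p = 0 := by simp [baseHerm, hu1]
    rw [h3, mul_zero, add_zero]
    exact add_pos_of_nonneg_of_pos (mul_nonneg h1.le (Finset.sum_nonneg fun i _ => by positivity))
      (mul_pos h2 (by positivity))
  · obtain ⟨i, hi⟩ := Function.ne_iff.1 hu1
    have hi' : u.1 i ≠ 0 := hi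
    refine add_pos_of_pos_of_nonneg (mul_pos h1 ?_) (mul_nonneg h2.le (by positivity))
    exact Finset.sum_pos' (fun i _ => by positivity) ⟨i, Finset.mem_univ i, by positivity⟩

theorem bergmanRiemannian_apply {E : Type*} [NormedAddCommGroup E] [NormedSpace ℂ E]
    [NormedSpace ℝ E] [IsScalarTower ℝ ℂ E] [MeasureSpace E] {Ω : Set E} {J : Type*}
    (φ : HilbertBasis J ℂ (BergmanSpace Ω)) (p u v : E) :
    bergmanRiemannian φ p u v = (bergmanMetric φ p u v).re :=
  (re_complexHessian _ p u v).symm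

end Metric

/-! ### Geometry of the slice -/

section Geometry

open Filter Topology

/-- An even function of one variable has zero derivative at `0`. In the non-differentiable case
`fderiv` is `0` by convention, so no regularity of the metric or of the Christoffel symbols has to
be established. -/
theorem fderiv_apply_eq_zero_of_even {E F : Type*} [NormedAddCommGroup E] [NormedSpace ℝ E]
    [NormedAddCommGroup F] [NormedSpace ℝ F] {f : E → F} {p e : E}
    (h : ∀ᶠ s : ℝ in 𝓝 0, f (p + (-s) • e) = f (p + s • e)) : fderiv ℝ f p e = 0 := by
  by_cases hf : DifferentiableAt ℝ f p
  · have hline : ∀ c : ℝ, HasDerivAt (fun s : ℝ => f (p + (c * s) • e)) (fderiv ℝ f p (c • e)) 0 := by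
      intro c
      have h1 : HasDerivAt (fun s : ℝ => p + (c * s) • e) (c • e) 0 := by
        simpa using (((hasDerivAt_id (0 : ℝ)).const_mul c).smul_const e).const_add p
      have h2 : HasFDerivAt f (fderiv ℝ f p) (p + (c * 0) • e) := by
        simpa using hf.hasFDerivAt
      exact h2.comp_hasDerivAt (0 : ℝ) h1
    have h1 := hline 1
    have h2 := hline (-1)
    simp only [one_mul, neg_one_mul, one_smul] at h1 h2
    have h3 := h2.unique (h1.congr_of_eventuallyEq h)
    rw [neg_one_smul, map_neg] at h3
    have h4 : (2 : ℝ) • fderiv ℝ f p e = 0 := by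
      rw [two_smul]
      nth_rewrite 1 [← h3]
      exact neg_add_cancel _
    exact (smul_eq_zero.1 h4).resolve_left two_ne_zero
  · rw [fderiv_zero_of_not_differentiableAt hf, zero_apply]

theorem fderiv_apply_apply_apply_eq_zero_of_even {E : Type*} [NormedAddCommGroup E]
    [NormedSpace ℝ E] {h : E → E →L[ℝ] E →L[ℝ] ℝ} {p e a b : E}
    (heven : ∀ᶠ s : ℝ in 𝓝 0, h (p + (-s) • e) a b = h (p + s • e) a b) :
    fderiv ℝ h p e a b = 0 := by
  by_cases hf : DifferentiableAt ℝ h p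
  · have h1 := fderiv_apply_eq_zero_of_even (f := fun q => h q a b) heven
    have h2 : HasFDerivAt (fun q => h q a b) _ p :=
      (hf.hasFDerivAt.clm_apply (hasFDerivAt_const a p)).clm_apply (hasFDerivAt_const b p)
    rw [h2.fderiv] at h1
    simpa using h1
  · rw [fderiv_zero_of_not_differentiableAt hf]
    rfl

variable {n : ℕ} {J : Type*} (φ : HilbertBasis J ℂ (BergmanSpace (hartogsDomain n)))

theorem sliceEmbedding_eq_inl (n : ℕ) :
    sliceEmbedding n = ContinuousLinearMap.inl ℝ (Fin n → ℂ) ℂ := rfl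

theorem fderiv_sliceEmbedding (z : Fin n → ℂ) :
    fderiv ℝ (sliceEmbedding n) z = ContinuousLinearMap.inl ℝ (Fin n → ℂ) ℂ := by
  rw [sliceEmbedding_eq_inl, ContinuousLinearMap.fderiv]

theorem fderiv_sliceEmbedding_apply (z u : Fin n → ℂ) :
    fderiv ℝ (sliceEmbedding n) z u = (u, 0) := by
  rw [fderiv_sliceEmbedding]
  rfl

theorem slice_mem_hartogsDomain (z : Fin n → ℂ) : ((z, 0) : (Fin n → ℂ) × ℂ) ∈ hartogsDomain n := by
  simp [mem_hartogsDomain, Real.exp_pos]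

/-- At `w = 0` the quotient of series is `1` and the factor `u.2 + p.2 * baseHerm u p` vanishes for
tangent `u`. As `v` is arbitrary, this also shows that the fibre direction is orthogonal to the
slice. -/
theorem bergmanMetric_slice (z u : Fin n → ℂ) (v : (Fin n → ℂ) × ℂ) :
    bergmanMetric φ (z, 0) (u, 0) v = ∑ i, u i * (starRingEnd ℂ) (v.1 i) := by
  have ht : hartogsDefining ((z, 0) : (Fin n → ℂ) × ℂ) = 0 := by simp [hartogsDefining]
  rw [bergmanMetric_hartogsDomain φ (slice_mem_hartogsDomain z), ht, succPowSeries_zero_right,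
    succPowSeries_zero_right]
  simp [baseHerm]

theorem bergmanRiemannian_slice (z u : Fin n → ℂ) (v : (Fin n → ℂ) × ℂ) :
    bergmanRiemannian φ (z, 0) (u, 0) v = (∑ i, u i * (starRingEnd ℂ) (v.1 i)).re := by
  rw [bergmanRiemannian_apply, bergmanMetric_slice]

/-- The isometry `(z, w) ↦ (z, -w)` on tangential entries: `t` is even in `w`, and the second term
contains `w` only through `w * conj w`. -/
theorem bergmanRiemannian_neg_snd {z : Fin n → ℂ} {w : ℂ} (h : (z, w) ∈ hartogsDomain n)
    (u v : Fin n → ℂ) :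
    bergmanRiemannian φ (z, -w) (u, 0) (v, 0) = bergmanRiemannian φ (z, w) (u, 0) (v, 0) := by
  have ht : hartogsDefining (z, -w) = hartogsDefining (z, w) := by simp [hartogsDefining]
  have h' : (z, -w) ∈ hartogsDomain n := by
    rw [mem_hartogsDomain_iff, ht]
    exact mem_hartogsDomain_iff.1 h
  rw [bergmanRiemannian_apply, bergmanRiemannian_apply, bergmanMetric_hartogsDomain φ h,
    bergmanMetric_hartogsDomain φ h', ht]
  simp only [baseHerm, zero_add, map_mul, map_neg]
  congr 3
  ring

theorem fderiv_bergmanRiemannian_slice_tangent (z u v : Fin n → ℂ) (x : (Fin n → ℂ) × ℂ) :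
    fderiv ℝ (bergmanRiemannian φ) (z, 0) (u, 0) (v, 0) x = 0 := by
  -- Along the slice this entry is constant, in particular even.
  refine fderiv_apply_apply_apply_eq_zero_of_even (Eventually.of_forall fun s => ?_)
  simp only [Prod.smul_mk, Prod.mk_add_mk, smul_zero, add_zero]
  rw [bergmanRiemannian_slice, bergmanRiemannian_slice]

theorem fderiv_bergmanRiemannian_slice_normal (z : Fin n → ℂ) (r : ℂ) (u v : Fin n → ℂ) :
    fderiv ℝ (bergmanRiemannian φ) (z, 0) (0, r) (u, 0) (v, 0) = 0 := by
  refine fderiv_apply_apply_apply_eq_zero_of_even ?_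
  simp only [Prod.smul_mk, Prod.mk_add_mk, Prod.neg_mk, neg_zero, smul_zero, add_zero, zero_add,
    neg_smul]
  have hc : Continuous fun s : ℝ => ((z, s • r) : (Fin n → ℂ) × ℂ) := by fun_prop
  have hnear : ∀ᶠ s : ℝ in 𝓝 0, (z, s • r) ∈ hartogsDomain n :=
    hc.continuousAt.eventually_mem ((isOpen_hartogsDomain n).mem_nhds
      (by simpa using slice_mem_hartogsDomain z))
  filter_upwards [hnear] with s hs
  exact bergmanRiemannian_neg_snd φ hs u v

/-- Two of the three terms differentiate along the slice. The third differentiates a tangential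
entry in an arbitrary direction, whose tangential part is killed by constancy and normal part by the
reflection. -/
theorem christoffelLower_slice (z u v : Fin n → ℂ) :
    christoffelLower (bergmanRiemannian φ) (z, 0) (u, 0) (v, 0) = 0 := by
  refine ContinuousLinearMap.ext fun ⟨y, r⟩ => ?_
  have hsplit : ((y, r) : (Fin n → ℂ) × ℂ) = (y, 0) + (0, r) := by simp
  have h3 : fderiv ℝ (bergmanRiemannian φ) (z, 0) (y, r) (u, 0) (v, 0) = 0 := by
    rw [hsplit, map_add, add_apply, add_apply, fderiv_bergmanRiemannian_slice_tangent,
      fderiv_bergmanRiemannian_slice_normal, add_zero]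
  simp only [christoffelLower, smul_apply, sub_apply, add_apply, ContinuousLinearMap.flip_apply,
    fderiv_bergmanRiemannian_slice_tangent, h3, add_zero, sub_zero, smul_zero, zero_apply]

theorem christoffel_slice (z u v : Fin n → ℂ) :
    christoffel (bergmanRiemannian φ) (z, 0) (u, 0) (v, 0) = 0 := by
  rw [christoffel, christoffelLower_slice, map_zero]

/-- With tangent arguments the derivative terms differentiate, along the slice, Christoffel symbols
that vanish on it; the quadratic terms contain the same symbols. -/
theorem riemannCurvature_slice (z u v x : Fin n → ℂ) :
    riemannCurvature (bergmanRiemannian φ) (z, 0) (u, 0) (v, 0) (x, 0) = 0 := by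
  have h : ∀ a b c : Fin n → ℂ, fderiv ℝ (fun q => christoffel (bergmanRiemannian φ) q (a, 0) (b, 0))
      ((z, 0) : (Fin n → ℂ) × ℂ) (c, 0) = 0 := by
    intro a b c
    refine fderiv_apply_eq_zero_of_even (Eventually.of_forall fun s => ?_)
    simp only [Prod.smul_mk, Prod.mk_add_mk, smul_zero, add_zero, christoffel_slice]
  have h0 : ((0 : Fin n → ℂ), (0 : ℂ)) = 0 := rfl
  have h1 : ∀ a : Fin n → ℂ,
      christoffel (bergmanRiemannian φ) ((z, 0) : (Fin n → ℂ) × ℂ) (a, 0) 0 = 0 := fun a =>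
    christoffel_slice φ z a 0
  simp only [riemannCurvature, h, christoffel_slice, h1, sub_zero, add_zero]

theorem isTotallyGeodesic_slice :
    IsTotallyGeodesic (bergmanRiemannian φ) (sliceEmbedding n) := by
  intro z u v ν _
  have h1 : fderiv ℝ (sliceEmbedding n) = fun _ => ContinuousLinearMap.inl ℝ (Fin n → ℂ) ℂ :=
    funext fderiv_sliceEmbedding
  -- The whole covariant derivative vanishes, not only its normal component.
  have h2 : covDerivAlong (bergmanRiemannian φ) (sliceEmbedding n) z u v = 0 := by
    rw [covDerivAlong, fderiv_sliceEmbedding_apply, fderiv_sliceEmbedding_apply, h1]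
    have : christoffel (bergmanRiemannian φ) (sliceEmbedding n z) (u, 0) (v, 0) = 0 :=
      christoffel_slice φ z u v
    rw [this, fderiv_fun_const]
    simp
  rw [h2, map_zero, zero_apply]

theorem inducedMetric_slice_eq (z z' : Fin n → ℂ) :
    inducedMetric (bergmanRiemannian φ) (sliceEmbedding n) z =
      inducedMetric (bergmanRiemannian φ) (sliceEmbedding n) z' := by
  have h : ∀ x u v : Fin n → ℂ, inducedMetric (bergmanRiemannian φ) (sliceEmbedding n) x u v =
      (∑ i, u i * (starRingEnd ℂ) (v i)).re := by
    intro x u v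
    rw [inducedMetric, ContinuousLinearMap.bilinearComp_apply, fderiv_sliceEmbedding_apply,
      fderiv_sliceEmbedding_apply]
    exact bergmanRiemannian_slice φ x u (v, 0)
  ext1 u
  ext1 v
  rw [h, h]

theorem riemannCurvature_of_const {E : Type*} [NormedAddCommGroup E] [NormedSpace ℝ E]
    {h : E → E →L[ℝ] E →L[ℝ] ℝ} (hc : ∀ p q, h p = h q) (p u v x : E) :
    riemannCurvature h p u v x = 0 := by
  have h1 : h = fun _ => h p := funext fun q => hc q p
  have h2 : ∀ q a b, christoffel h q a b = 0 := by
    intro q a b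
    have h3 : fderiv ℝ h q = 0 := by
      rw [h1, fderiv_fun_const]
      rfl
    have h4 : christoffelLower h q a b = 0 := by
      ext1 w
      simp [christoffelLower, h3]
    rw [christoffel, h4, map_zero]
  simp [riemannCurvature, h2]

theorem holSectionalCurvature_slice (z u : Fin n → ℂ) :
    holSectionalCurvature (bergmanRiemannian φ) (sliceEmbedding n z)
      (fderiv ℝ (sliceEmbedding n) z u) = 0 := by
  have hI : mulI ((Fin n → ℂ) × ℂ) (u, 0) = (Complex.I • u, 0) := by
    rw [mulI_apply, Prod.smul_mk, smul_zero]
  have h : riemannCurvature (bergmanRiemannian φ) (sliceEmbedding n z) (u, 0) (Complex.I • u, 0)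
      (Complex.I • u, 0) = 0 := riemannCurvature_slice φ z u _ _
  rw [holSectionalCurvature, fderiv_sliceEmbedding_apply, hI, h, map_zero, zero_apply, zero_div]

theorem isClosedEmbedding_sliceEmbedding (n : ℕ) :
    Topology.IsClosedEmbedding (sliceEmbedding n) := by
  refine Topology.IsClosedEmbedding.of_continuous_injective_isClosedMap
    (sliceEmbedding_eq_inl n ▸ ContinuousLinearMap.continuous _)
    (fun z z' h => congrArg Prod.fst h) fun s hs => ?_
  have : sliceEmbedding n '' s = s ×ˢ {0} := by
    ext ⟨z, w⟩
    simp only [sliceEmbedding, Set.mem_image, Prod.mk.injEq, Set.mem_prod, Set.mem_singleton_iff]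
    constructor
    · rintro ⟨x, hx, rfl, rfl⟩
      exact ⟨hx, rfl⟩
    · rintro ⟨hz, rfl⟩
      exact ⟨z, hz, rfl, rfl⟩
  rw [this]
  exact hs.prod isClosed_singleton

theorem differentiable_sliceEmbedding (n : ℕ) : Differentiable ℂ (sliceEmbedding n) :=
  (ContinuousLinearMap.inl ℂ (Fin n → ℂ) ℂ).differentiable

theorem injective_fderiv_sliceEmbedding (z : Fin n → ℂ) :
    Function.Injective (fderiv ℂ (sliceEmbedding n) z) := by
  have h : fderiv ℂ (sliceEmbedding n) z = ContinuousLinearMap.inl ℂ (Fin n → ℂ) ℂ :=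
    (ContinuousLinearMap.inl ℂ (Fin n → ℂ) ℂ).fderiv
  rw [h]
  exact fun a b hab => congrArg Prod.fst hab

end Geometry

/-! ### Connectedness and pseudoconvexity of the domain -/

section Pseudoconvex

open Metric

/-- The sub-mean value inequality for a function that is touched from below at the centre by the
real part of a holomorphic function. -/
theorem le_circleAverage_of_re_le {E : Type*} [NormedAddCommGroup E] [NormedSpace ℂ E]
    {φ : E → ℝ} {Ω : Set E} (hφ : ContinuousOn φ Ω) {G : E → ℂ} (hG : DifferentiableOn ℂ G Ω)
    (hle : ∀ x ∈ Ω, (G x).re ≤ φ x) {p v : E} (hp : (G p).re = φ p)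
    (hv : ∀ ζ : ℂ, ‖ζ‖ ≤ 1 → p + ζ • v ∈ Ω) :
    φ p ≤ Real.circleAverage (fun ζ : ℂ => φ (p + ζ • v)) 0 1 := by
  have hmaps : Set.MapsTo (fun ζ : ℂ => p + ζ • v) (closedBall 0 |1|) Ω := fun ζ hζ =>
    hv ζ (by simpa using hζ)
  have hd : DifferentiableOn ℂ (fun ζ : ℂ => G (p + ζ • v)) (closedBall 0 |1|) :=
    hG.comp (by fun_prop) hmaps
  have havg : Real.circleAverage (fun ζ : ℂ => G (p + ζ • v)) 0 1 = G p := by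
    simpa using (hd.diffContOnCl_ball (Set.Subset.refl _)).circleAverage
  have hsub : sphere (0 : ℂ) |1| ⊆ closedBall 0 |1| := sphere_subset_closedBall
  have hGi : CircleIntegrable (fun ζ : ℂ => G (p + ζ • v)) 0 1 :=
    (hd.continuousOn.mono hsub).circleIntegrable'
  have hre : ContinuousOn (fun ζ : ℂ => (G (p + ζ • v)).re) (sphere 0 |1|) :=
    Complex.continuous_re.comp_continuousOn (hd.continuousOn.mono hsub)
  have hφc : ContinuousOn (fun ζ : ℂ => φ (p + ζ • v)) (sphere 0 |1|) :=
    hφ.comp (by fun_prop) (hmaps.mono_left hsub)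
  have hcomm : Real.circleAverage (fun ζ : ℂ => (G (p + ζ • v)).re) 0 1 = (G p).re := by
    rw [← havg]
    exact Complex.reCLM.circleAverage_comp_comm hGi
  rw [← hp, ← hcomm]
  exact Real.circleAverage_mono hre.circleIntegrable' hφc.circleIntegrable'
    fun ζ hζ => hle _ (hmaps (hsub hζ))

theorem isConnected_hartogsDomain (n : ℕ) : IsConnected (hartogsDomain n) := by
  refine (StarConvex.isPathConnected (a := 0) ?_ (zero_mem_hartogsDomain n)).isConnected
  rw [starConvex_zero_iff]
  intro p hp a ha0 ha1
  have h : (a : ℂ) • p ∈ hartogsDomain n :=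
    smul_mem_hartogsDomain (by rwa [Complex.norm_real, Real.norm_of_nonneg ha0]) hp
  rwa [Complex.coe_smul] at h

/-- The exhaustion function `|z|² + 1 / (1 - |w|² exp |z|²)`. -/
noncomputable def hartogsExhaustion {n : ℕ} (p : (Fin n → ℂ) × ℂ) : ℝ :=
  ∑ i, ‖p.1 i‖ ^ 2 + (1 - hartogsDefining p)⁻¹

theorem continuousOn_hartogsExhaustion (n : ℕ) :
    ContinuousOn hartogsExhaustion (hartogsDomain n) := by
  unfold hartogsExhaustion
  refine ContinuousOn.add (by fun_prop) (ContinuousOn.inv₀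
    (continuousOn_const.sub contDiff_hartogsDefining.continuous.continuousOn) fun p hp => ?_)
  exact (sub_pos.2 (mem_hartogsDomain_iff.1 hp)).ne'

theorem isCompact_hartogsExhaustion_le (n : ℕ) (c : ℝ) :
    IsCompact {p | p ∈ hartogsDomain n ∧ hartogsExhaustion p ≤ c} := by
  -- Clearing the denominator expresses the sublevel set by closed conditions on the whole space.
  -- The bound `1 - (max c 1)⁻¹` keeps it away from the boundary `t = 1`; the maximum with `1`
  -- guarantees a positive constant.
  have heq : {p | p ∈ hartogsDomain n ∧ hartogsExhaustion p ≤ c} =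
      {p : (Fin n → ℂ) × ℂ | hartogsDefining p ≤ 1 - (max c 1)⁻¹ ∧
        (∑ i, ‖p.1 i‖ ^ 2 - c) * (1 - hartogsDefining p) + 1 ≤ 0} := by
    have hm : (0 : ℝ) < max c 1 := lt_max_of_lt_right one_pos
    ext p
    simp only [Set.mem_ofPred_eq, mem_hartogsDomain_iff]
    have key : hartogsDefining p < 1 → (hartogsExhaustion p ≤ c ↔
        (∑ i, ‖p.1 i‖ ^ 2 - c) * (1 - hartogsDefining p) + 1 ≤ 0) := by
      intro h
      have h' : 0 < 1 - hartogsDefining p := sub_pos.2 h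
      have : (∑ i, ‖p.1 i‖ ^ 2 - c) * (1 - hartogsDefining p) + 1 =
          (hartogsExhaustion p - c) * (1 - hartogsDefining p) := by
        unfold hartogsExhaustion
        field_simp
        ring
      rw [this, ← sub_nonpos]
      exact ⟨fun h2 => mul_nonpos_of_nonpos_of_nonneg h2 h'.le, fun h2 =>
        le_of_mul_le_mul_right (by rwa [zero_mul]) h'⟩
    constructor
    · rintro ⟨h1, h2⟩
      refine ⟨?_, (key h1).1 h2⟩
      have h3 : (1 - hartogsDefining p)⁻¹ ≤ max c 1 := by
        refine le_trans ?_ (le_max_left c 1)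
        have : 0 ≤ ∑ i, ‖p.1 i‖ ^ 2 := by positivity
        unfold hartogsExhaustion at h2
        linarith
      have := inv_le_of_inv_le₀ (sub_pos.2 h1) h3
      linarith
    · rintro ⟨h1, h2⟩
      have h3 : hartogsDefining p < 1 := h1.trans_lt (by simp [hm])
      exact ⟨h3, (key h3).2 h2⟩
  have hcont : Continuous (hartogsDefining (n := n)) := contDiff_hartogsDefining.continuous
  refine Metric.isCompact_of_isClosed_isBounded ?_ ?_
  · rw [heq]
    exact (isClosed_le hcont continuous_const).inter (isClosed_le
      ((((continuous_finsetSum _ fun i _ => by fun_prop).sub continuous_const).mul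
        (continuous_const.sub hcont)).add continuous_const) continuous_const)
  · refine isBounded_closedBall (x := (0 : (Fin n → ℂ) × ℂ)) (r := max (Real.sqrt c) 1) |>.subset ?_
    rintro ⟨z, w⟩ ⟨h1, h2⟩
    have ht := mem_hartogsDomain_iff.1 h1
    have hinv : 0 ≤ (1 - hartogsDefining (z, w))⁻¹ := inv_nonneg.2 (sub_nonneg.2 ht.le)
    have hsum : ∑ i, ‖z i‖ ^ 2 ≤ c := by
      unfold hartogsExhaustion at h2
      linarith
    rw [mem_closedBall_zero_iff, Prod.norm_def]
    refine max_le_max ((pi_norm_le_iff_of_nonneg (Real.sqrt_nonneg c)).2 fun i => ?_) ?_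
    · refine Real.le_sqrt_of_sq_le (le_trans ?_ hsum)
      exact Finset.single_le_sum (f := fun i => ‖z i‖ ^ 2) (fun j _ => by positivity)
        (Finset.mem_univ i)
    · have he : 1 ≤ Real.exp (∑ i, ‖z i‖ ^ 2) := Real.one_le_exp (by positivity)
      unfold hartogsDefining at ht
      have : ‖w‖ ^ 2 ≤ 1 := by
        have := le_mul_of_one_le_right (sq_nonneg ‖w‖) he
        exact this.trans ht.le
      exact (sq_le_one_iff₀ (norm_nonneg w)).1 this

/-- At the point `(z₀, w₀)` the support function is the real part of `s + 1/(1 - g)`. Here `s` is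
the complex affine function with `|z|² - Re s = |z - z₀|²`, and `g = κ w² exp s` satisfies `|g| ≤
t`, with `g = t` at that point. Then `Re (1/(1 - g)) ≤ 1/(1 - |g|) ≤ 1/(1 - t)`. -/
theorem isPseudoconvex_hartogsDomain (n : ℕ) : IsPseudoconvex (hartogsDomain n) := by
  refine ⟨isOpen_hartogsDomain n, hartogsExhaustion,
    ⟨continuousOn_hartogsExhaustion n, fun p v hv => ?_⟩, isCompact_hartogsExhaustion_le n⟩
  obtain ⟨z₀, w₀⟩ := p
  set N : ℝ := ∑ i, ‖z₀ i‖ ^ 2 with hN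
  -- This phase makes `κ * w₀ ^ 2 = ‖w₀‖ ^ 2`. For `w₀ = 0` the division convention gives `κ = 0`,
  -- which still satisfies both requirements.
  set κ : ℂ := (starRingEnd ℂ) w₀ / w₀ with hκ
  have hκ1 : ‖κ‖ ≤ 1 := by
    rw [hκ, norm_div, RCLike.norm_conj]
    exact div_self_le_one _
  have hκw : κ * w₀ ^ 2 = ((‖w₀‖ ^ 2 : ℝ) : ℂ) := by
    rcases eq_or_ne w₀ 0 with rfl | h
    · simp
    · rw [hκ, Complex.ofReal_pow, ← Complex.conj_mul']
      field_simp
  let s : (Fin n → ℂ) × ℂ → ℂ := fun q => 2 * ∑ i, (starRingEnd ℂ) (z₀ i) * q.1 i - (N : ℂ)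
  let g : (Fin n → ℂ) × ℂ → ℂ := fun q => κ * q.2 ^ 2 * Complex.exp (s q)
  have hs_le : ∀ q, (s q).re ≤ ∑ i, ‖q.1 i‖ ^ 2 := by
    intro q
    have h : ∑ i, ‖q.1 i‖ ^ 2 - (s q).re = ∑ i, ‖q.1 i - z₀ i‖ ^ 2 := by
      simp only [s, hN, Complex.sub_re, Complex.ofReal_re]
      rw [show (2 : ℂ) = ((2 : ℝ) : ℂ) by norm_num, Complex.re_ofReal_mul, Complex.re_sum,
        Finset.mul_sum, ← Finset.sum_sub_distrib, ← Finset.sum_sub_distrib]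
      refine Finset.sum_congr rfl fun i _ => ?_
      simp only [Complex.sq_norm, Complex.normSq_apply, Complex.mul_re, Complex.conj_re,
        Complex.conj_im, Complex.sub_re, Complex.sub_im]
      ring
    have : 0 ≤ ∑ i, ‖q.1 i - z₀ i‖ ^ 2 := by positivity
    linarith
  have hg_le : ∀ q, ‖g q‖ ≤ hartogsDefining q := by
    intro q
    simp only [g, norm_mul, norm_pow, Complex.norm_exp, hartogsDefining]
    gcongr
    · exact mul_le_of_le_one_left (by positivity) hκ1
    · exact hs_le q
  have hs0 : s (z₀, w₀) = (N : ℂ) := by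
    simp only [s, hN, Complex.conj_mul']
    push_cast
    ring
  have hg0 : g (z₀, w₀) = ((hartogsDefining (z₀, w₀) : ℝ) : ℂ) := by
    simp only [g, hs0, hκw, hartogsDefining, ← hN]
    push_cast
    ring
  have hg_ne : ∀ q ∈ hartogsDomain n, 1 - g q ≠ 0 := by
    intro q hq h
    have h1 : ‖g q‖ = 1 := by rw [← sub_eq_zero.1 h, norm_one]
    exact absurd (h1 ▸ hg_le q) (not_le.2 (mem_hartogsDomain_iff.1 hq))
  refine le_circleAverage_of_re_le (G := fun q => s q + (1 - g q)⁻¹)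
    (continuousOn_hartogsExhaustion n) ?_ ?_ ?_ hv
  · have hs : Differentiable ℂ s := by fun_prop
    have hg : Differentiable ℂ g := by fun_prop
    exact hs.differentiableOn.add ((hg.const_sub 1).differentiableOn.inv hg_ne)
  · intro q hq
    have ht : 0 < 1 - hartogsDefining q := sub_pos.2 (mem_hartogsDomain_iff.1 hq)
    have h1 : 1 - hartogsDefining q ≤ ‖1 - g q‖ := by
      have := norm_sub_norm_le 1 (g q)
      rw [norm_one] at this
      linarith [hg_le q]
    have h2 : ((1 - g q)⁻¹).re ≤ (1 - hartogsDefining q)⁻¹ :=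
      (Complex.re_le_norm _).trans (by
        rw [norm_inv]
        exact inv_anti₀ ht h1)
    exact add_le_add (hs_le q) h2
  · simp only [hs0, hg0, hartogsExhaustion, ← hN]
    norm_cast

end Pseudoconvex

theorem mainTheorem9 (n : ℕ) :
    -- `D` is a pseudoconvex (complete Reinhardt) domain
    (IsConnected (hartogsDomain n) ∧ IsCompleteReinhardt (hartogsDomain n) ∧
      IsPseudoconvex (hartogsDomain n)) ∧
    -- the monomials are square integrable, pairwise orthogonal, and have the stated norms
    (∀ (α : Fin n → ℕ) (q : ℕ),
      MemLp (hartogsMonomial α q) 2 (volume.restrict (hartogsDomain n)) ∧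
      ∫ p in hartogsDomain n, ‖hartogsMonomial α q p‖ ^ 2 = hartogsNormSq α q) ∧
    (∀ (α β : Fin n → ℕ) (q r : ℕ), (α, q) ≠ (β, r) →
      ∫ p in hartogsDomain n, hartogsMonomial α q p * (starRingEnd ℂ) (hartogsMonomial β r p) = 0) ∧
    -- normalized, they are a Hilbert basis of the Bergman space
    (∃ b : HilbertBasis ((Fin n → ℕ) × ℕ) ℂ (BergmanSpace (hartogsDomain n)),
      ∀ (α : Fin n → ℕ) (q : ℕ), ∀ p ∈ hartogsDomain n,
        holomorphicRep (b (α, q)) p = hartogsMonomial α q p / (Real.sqrt (hartogsNormSq α q) : ℂ)) ∧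
    -- the slice is a closed complex submanifold of `D`
    ((∀ z : Fin n → ℂ, sliceEmbedding n z ∈ hartogsDomain n) ∧
      Differentiable ℂ (sliceEmbedding n) ∧ Topology.IsClosedEmbedding (sliceEmbedding n) ∧
      ∀ z : Fin n → ℂ, Function.Injective (fderiv ℂ (sliceEmbedding n) z)) ∧
    ∀ (J : Type*) (φ : HilbertBasis J ℂ (BergmanSpace (hartogsDomain n))),
      -- the Bergman metric of `D` is well defined
      (∀ p ∈ hartogsDomain n, Summable (fun j => ‖holomorphicRep (φ j) p‖ ^ 2) ∧ 0 < bergmanKernel φ p) ∧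
      ContDiffOn ℝ ∞ (bergmanKernel φ) (hartogsDomain n) ∧
      (∀ p ∈ hartogsDomain n, ∀ u : (Fin n → ℂ) × ℂ, u ≠ 0 →
        (bergmanMetric φ p u u).im = 0 ∧ 0 < (bergmanMetric φ p u u).re) ∧
      -- it restricts to the Euclidean metric on the slice
      (∀ z u v : Fin n → ℂ, bergmanMetric φ (sliceEmbedding n z)
          (fderiv ℝ (sliceEmbedding n) z u) (fderiv ℝ (sliceEmbedding n) z v) =
        ∑ i, u i * (starRingEnd ℂ) (v i)) ∧
      -- the slice is totally geodesic
      IsTotallyGeodesic (bergmanRiemannian φ) (sliceEmbedding n) ∧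
      -- and flat: its induced metric has zero curvature, and the holomorphic sectional curvature
      -- of `D` vanishes in the directions tangent to it
      (∀ z u v x : Fin n → ℂ,
        riemannCurvature (inducedMetric (bergmanRiemannian φ) (sliceEmbedding n)) z u v x = 0) ∧
      (∀ z u : Fin n → ℂ, u ≠ 0 → holSectionalCurvature (bergmanRiemannian φ)
        (sliceEmbedding n z) (fderiv ℝ (sliceEmbedding n) z u) = 0) := by
  refine ⟨⟨isConnected_hartogsDomain n, isCompleteReinhardt_hartogsDomain n,
      isPseudoconvex_hartogsDomain n⟩,
    fun α q => ⟨memLp_hartogsMonomial α q, integral_norm_hartogsMonomial_sq α q⟩,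
    fun α β q r h => integral_hartogsMonomial_mul_conj h,
    ⟨monomialBasis n, fun α q p hp => holomorphicRep_monomialBasis α q hp⟩,
    ⟨slice_mem_hartogsDomain, differentiable_sliceEmbedding n, isClosedEmbedding_sliceEmbedding n,
      injective_fderiv_sliceEmbedding⟩,
    fun J φ => ⟨fun p hp => ⟨(hasSum_norm_holomorphicRep_sq (isOpen_hartogsDomain n) φ hp).summable,
        bergmanKernel_hartogsDomain_pos φ hp⟩,
      contDiffOn_bergmanKernel_hartogsDomain φ,
      fun p hp u hu => bergmanMetric_hartogsDomain_pos φ hp hu,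
      fun z u v => ?_,
      isTotallyGeodesic_slice φ,
      riemannCurvature_of_const (inducedMetric_slice_eq φ),
      fun z u _ => holSectionalCurvature_slice φ z u⟩⟩
  rw [fderiv_sliceEmbedding_apply, fderiv_sliceEmbedding_apply]
  exact bergmanMetric_slice φ z u (v, 0)
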